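/- Let $D,m\ge 1$ and $n_1,\dots,n_D\ge 1$ be integers. Equip $\mathbb R^{n_1\times\cdots\times n_D}$ with the scalar product $\langle \mathcal X,\mathcal Y\rangle=\sum_{i_1,\dots,i_D}\mathcal X_{i_1,\dots,i_D}\,\mathcal Y_{i_1,\dots,i_D}$, the Frobenius norm $\|\mathcal X\|_F=\sqrt{\langle \mathcal X,\mathcal X\rangle}$, the spectral norm $$\|\mathcal X\|=\max\bigl\{\langle \mathcal X,u^{(1)}\otimes\cdots\otimes u^{(D)}\rangle:\ u^{(d)}\in\mathbb R^{n_d},\ \|u^{(d)}\|_2=1,\ d=1,\dots,D\bigr\},$$ and the nuclear norm $$\|\mathcal X\|_*=\max\bigl\{\langle \mathcal X,\mathcal Y\rangle:\ \mathcal Y\in\mathbb R^{n_1\times\cdots\times n_D},\ \|\mathcal Y\|\le 1\bigr\}.$$ Let $\mathcal G_1,\dots,\mathcal G_m$ be independent random tensors in $\mathbb R^{n_1\times\cdots\times n_D}$, each with independent $\mathcal N(0,1)$ entries, let $\mathcal X^\sharp\in\mathbb R^{n_1\times\cdots\times n_D}$ be a fixed tensor, and let $y_i=\langle \mathcal G_i,\mathcal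 X^\sharp\rangle$ for $i=1,\dots,m$. Let $\hat{\mathcal X}$ be a random tensor which is almost surely a solution of the convex program $$\min_{\mathcal X\in\mathbb R^{n_1\times\cdots\times n_D}}\|\mathcal X\|_*\quad\text{subject to}\quad \langle \mathcal G_i,\mathcal X\rangle=y_i,\quad i=1,\dots,m.$$ Then $\|\hat{\mathcal X}-\mathcal X^\sharp\|_F$ is integrable and $$\mathbb E\,\bigl\|\hat{\mathcal X}-\mathcal X^\sharp\bigr\|_F\ \le\ 4\sqrt{\pi}\ \frac{\sqrt{n_1}+\cdots+\sqrt{n_D}}{\sqrt m}\ \|\mathcal X^\sharp\|_*.$$ -/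

import Mathlib

open MeasureTheory ProbabilityTheory

noncomputable section

/-- Real tensors of format `n 0 × ⋯ × n (D - 1)`. The Euclidean inner product
`inner ℝ X Y = ∑ i, X i * Y i` is the scalar product of tensors and the Euclidean norm
`‖X‖ = √(∑ i, X i ^ 2)` is the Frobenius norm. -/
abbrev RealTensor {D : ℕ} (n : Fin D → ℕ) : Type :=
  EuclideanSpace ℝ ((d : Fin D) → Fin (n d))

/-- The elementary tensor `u 0 ⊗ ⋯ ⊗ u (D - 1)`. -/
def RealTensor.elementary {D : ℕ} {n : Fin D → ℕ}
    (u : (d : Fin D) → EuclideanSpace ℝ (Fin (n d))) : RealTensor n :=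
  WithLp.toLp 2 (fun i => ∏ d, u d (i d))

/-- The spectral (operator) norm: the maximum of `⟨X, u 0 ⊗ ⋯ ⊗ u (D - 1)⟩` over
Euclidean unit vectors `u d`. -/
def RealTensor.spectralNorm {D : ℕ} {n : Fin D → ℕ} (X : RealTensor n) : ℝ :=
  sSup {r : ℝ | ∃ u : (d : Fin D) → EuclideanSpace ℝ (Fin (n d)),
    (∀ d, ‖u d‖ = 1) ∧ r = inner ℝ X (RealTensor.elementary u)}

/-- The nuclear norm: the maximum of `⟨X, Y⟩` over tensors `Y` of spectral norm at most one. -/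
def RealTensor.nuclearNorm {D : ℕ} {n : Fin D → ℕ} (X : RealTensor n) : ℝ :=
  sSup {r : ℝ | ∃ Y : RealTensor n, RealTensor.spectralNorm Y ≤ 1 ∧ r = inner ℝ X Y}

/-- `X` solves: minimise the nuclear norm subject to `⟨G i, X⟩ = y i` for all `i`. -/
def RealTensor.IsNuclearNormSolution {D : ℕ} {n : Fin D → ℕ} {m : ℕ}
    (G : Fin m → RealTensor n) (y : Fin m → ℝ) (X : RealTensor n) : Prop :=
  (∀ i, inner ℝ (G i) X = y i) ∧
    ∀ X' : RealTensor n, (∀ i, inner ℝ (G i) X' = y i) →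
      RealTensor.nuclearNorm X ≤ RealTensor.nuclearNorm X'

/-- A random tensor with independent `N(0, 1)` entries. -/
structure RealTensor.IsStdGaussian {D : ℕ} {n : Fin D → ℕ} {Ω : Type*} [MeasurableSpace Ω]
    (G : Ω → RealTensor n) (P : Measure Ω) : Prop where
  hasLaw_entry : ∀ j, HasLaw (fun ω => G ω j) (gaussianReal 0 1) P
  indep_entries : iIndepFun (fun j ω => G ω j) P

end

/-!
The error `h = Xhat - Xsharp` is annihilated by all measurements, and minimality of `Xhat` puts it
into the nuclear-norm ball `K` of radius `2 ‖Xsharp‖_*`. For a random vector `h` in the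
intersection of a bounded set `K` with the kernel of `m` Gaussian measurements,
`𝔼 ‖h‖ ≤ √(2π) w(K) / √m`, where `w` is the Gaussian width: since `𝔼 |⟨g, x⟩| = √(2/π) ‖x‖`, the
quantity `m √(2/π) ‖h‖` is at most `sup {∑ k, (𝔼 |⟨g, x⟩| - |⟨g k, x⟩|) : x ∈ K}`, and
symmetrization and contraction, one measurement at a time, bound its expectation by
`2 𝔼 sup {⟨∑ k, g k, x⟩ : x ∈ K} = 2 √m w(K)`.

By duality of the nuclear and the spectral norm, `w(K)` is at most the radius of `K` times the
expected spectral norm of a Gaussian tensor. The latter is bounded by `∑ d, √(n d)` through the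
Sudakov–Fernique inequality, comparing the process `⟨g, u 0 ⊗ ⋯ ⊗ u (D - 1)⟩` with
`∑ d, ⟨g d, u d⟩`, whose increments are larger. Sudakov–Fernique itself follows by rotating one
process into the other: Gaussian integration by parts shows that the expected free energy is
monotone along the rotation.
-/

section StdGaussian

variable {E : Type*} [NormedAddCommGroup E] [InnerProductSpace ℝ E]

/-- The density of the standard Gaussian measure on `E` with respect to the Lebesgue measure. -/
noncomputable def stdGaussianPDFReal (x : E) : ℝ :=
  (2 * Real.pi) ^ (-(Module.finrank ℝ E / 2 : ℝ)) * Real.exp (-(1 / 2) * ‖x‖ ^ 2)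

theorem stdGaussianPDFReal_nonneg (x : E) : 0 ≤ stdGaussianPDFReal x := by
  unfold stdGaussianPDFReal
  positivity

theorem hasFDerivAt_stdGaussianPDFReal (x : E) :
    HasFDerivAt stdGaussianPDFReal (-stdGaussianPDFReal x • innerSL ℝ x) x := by
  have h := ((hasStrictFDerivAt_norm_sq x).hasFDerivAt.const_mul (-(1 / 2 : ℝ))).exp.const_mul
    ((2 * Real.pi) ^ (-(Module.finrank ℝ E / 2 : ℝ)))
  convert! h using 1
  ext y
  simp [stdGaussianPDFReal]
  ring

variable [MeasurableSpace E] [BorelSpace E]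

theorem measurable_stdGaussianPDFReal : Measurable (stdGaussianPDFReal : E → ℝ) := by
  unfold stdGaussianPDFReal
  fun_prop

variable [FiniteDimensional ℝ E]

theorem integrable_stdGaussianPDFReal : Integrable (stdGaussianPDFReal : E → ℝ) := by
  have h : Integrable fun x : E => Real.exp (-(1 / 2) * ‖x‖ ^ 2) := by
    refine (GaussianFourier.integrable_cexp_neg_mul_sq_norm_add (V := E) (b := ((1 / 2 : ℝ) : ℂ))
      (by norm_num) 0 0).norm.congr (ae_of_all _ fun x => ?_)
    simp [Complex.norm_exp, ← Complex.ofReal_pow]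
  exact h.const_mul _

theorem integral_stdGaussianPDFReal_smul_cexp (t : E) :
    ∫ x, stdGaussianPDFReal x • Complex.exp ((inner ℝ x t : ℝ) * Complex.I) =
      Complex.exp (-(‖t‖ ^ 2 / 2)) := by
  have hpi : (2 * Real.pi : ℂ) ≠ 0 := by exact_mod_cast Real.two_pi_pos.ne'
  have hintegrand : ∀ x : E,
      stdGaussianPDFReal x • Complex.exp ((inner ℝ x t : ℝ) * Complex.I) =
        (2 * Real.pi : ℂ) ^ (-(Module.finrank ℝ E / 2 : ℂ)) *
          Complex.exp (-((1 / 2 : ℝ) : ℂ) * ‖x‖ ^ 2 + Complex.I * (inner ℝ t x : ℝ)) := by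
    intro x
    rw [stdGaussianPDFReal, Complex.real_smul, Complex.exp_add, real_inner_comm,
      mul_comm Complex.I, Complex.ofReal_mul, Complex.ofReal_cpow (by positivity)]
    push_cast
    ring
  have hbase : (Real.pi / ((1 / 2 : ℝ) : ℂ) : ℂ) = 2 * Real.pi := by
    push_cast
    ring
  simp_rw [hintegrand]
  rw [integral_const_mul, GaussianFourier.integral_cexp_neg_mul_sq_norm_add (by norm_num), hbase,
    ← mul_assoc, ← Complex.cpow_add _ _ hpi, neg_add_cancel, Complex.cpow_zero, one_mul]
  congr 1
  push_cast
  rw [Complex.I_sq]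
  ring

theorem stdGaussian_eq_withDensity :
    stdGaussian E = volume.withDensity fun x => ENNReal.ofReal (stdGaussianPDFReal x) := by
  have : IsFiniteMeasure (volume.withDensity fun x : E => ENNReal.ofReal (stdGaussianPDFReal x)) :=
    isFiniteMeasure_withDensity_ofReal integrable_stdGaussianPDFReal.hasFiniteIntegral
  apply Measure.ext_of_charFun
  ext t
  rw [charFun_stdGaussian, charFun_apply, integral_withDensity_eq_integral_toReal_smul
    measurable_stdGaussianPDFReal.ennreal_ofReal (by simp)]
  simp_rw [ENNReal.toReal_ofReal (stdGaussianPDFReal_nonneg _)]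
  rw [integral_stdGaussianPDFReal_smul_cexp, neg_div]

theorem integral_stdGaussian_eq_integral_smul {F : Type*} [NormedAddCommGroup F] [NormedSpace ℝ F]
    (f : E → F) : ∫ x, f x ∂(stdGaussian E) = ∫ x, stdGaussianPDFReal x • f x := by
  rw [stdGaussian_eq_withDensity, integral_withDensity_eq_integral_toReal_smul
    measurable_stdGaussianPDFReal.ennreal_ofReal (by simp)]
  simp_rw [ENNReal.toReal_ofReal (stdGaussianPDFReal_nonneg _)]

theorem integrable_stdGaussian_iff {F : Type*} [NormedAddCommGroup F] [NormedSpace ℝ F]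
    {f : E → F} :
    Integrable f (stdGaussian E) ↔ Integrable fun x => stdGaussianPDFReal x • f x := by
  rw [stdGaussian_eq_withDensity, integrable_withDensity_iff_integrable_smul'
    measurable_stdGaussianPDFReal.ennreal_ofReal (by simp)]
  simp_rw [ENNReal.toReal_ofReal (stdGaussianPDFReal_nonneg _)]

theorem integral_inner_mul_stdGaussian {ψ ψ' : E → ℝ} {v : E}
    (hψ : ∀ w, HasLineDerivAt ℝ ψ (ψ' w) w v) (hψi : Integrable ψ (stdGaussian E))
    (hψ'i : Integrable ψ' (stdGaussian E))
    (hψv : Integrable (fun w => inner ℝ w v * ψ w) (stdGaussian E)) :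
    ∫ w, inner ℝ w v * ψ w ∂(stdGaussian E) = ∫ w, ψ' w ∂(stdGaussian E) := by
  rw [integrable_stdGaussian_iff] at hψi hψ'i hψv
  have hρ : ∀ x : E, HasLineDerivAt ℝ stdGaussianPDFReal
      (-(stdGaussianPDFReal x * inner ℝ x v)) x v := fun x => by
    simpa using (hasFDerivAt_stdGaussianPDFReal x).hasLineDerivAt v
  have hparts := integral_bilinear_hasLineDerivAt_right_eq_neg_left_of_integrable
    (μ := (volume : Measure E)) (B := ContinuousLinearMap.mul ℝ ℝ)
    (f := stdGaussianPDFReal) (f' := fun x => -(stdGaussianPDFReal x * inner ℝ x v))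
    (g := ψ) (g' := ψ') (v := v) (hψv.neg.congr (ae_of_all _ fun x => by simp [mul_assoc]))
    hψ'i hψi (fun x _ => hρ x) (fun x _ => hψ x)
  rw [integral_stdGaussian_eq_integral_smul, integral_stdGaussian_eq_integral_smul]
  simpa [← integral_neg, mul_assoc] using hparts.symm

theorem integrable_norm_stdGaussian : Integrable (fun w : E => ‖w‖) (stdGaussian E) :=
  (IsGaussian.integrable_id (μ := stdGaussian E)).norm

theorem integrable_inner_stdGaussian (v : E) :
    Integrable (fun w : E => inner ℝ w v) (stdGaussian E) :=
  (IsGaussian.integrable_id (μ := stdGaussian E)).inner_const v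

theorem map_inner_stdGaussian (v : E) :
    (stdGaussian E).map (fun w => inner ℝ w v) = (gaussianReal 0 1).map (fun x => ‖v‖ * x) := by
  have hv : (fun w : E => inner ℝ w v) = innerSL ℝ v := by
    ext w
    exact real_inner_comm v w
  rw [hv, IsGaussian.map_eq_gaussianReal, integral_strongDual_stdGaussian,
    variance_dual_stdGaussian, gaussianReal_map_const_mul]
  congr 1
  · simp
  · ext
    simp

theorem integral_abs_gaussianReal : ∫ x, |x| ∂(gaussianReal 0 1) = √(2 / Real.pi) := by
  have hhalf : ∫ x in Set.Ioi (0 : ℝ), x * Real.exp (-(1 / 2) * x ^ 2) = 1 := by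
    have := integral_mul_cexp_neg_mul_sq (b := ((1 / 2 : ℝ) : ℂ)) (by norm_num)
    rw [← Complex.ofReal_inj, ← integral_complex_ofReal]
    simpa using this
  calc ∫ x, |x| ∂(gaussianReal 0 1)
      = ∫ x, (√(2 * Real.pi))⁻¹ * (|x| * Real.exp (-(1 / 2) * |x| ^ 2)) := by
        rw [integral_gaussianReal_eq_integral_smul (by norm_num)]
        refine integral_congr_ae (ae_of_all _ fun x => ?_)
        simp [gaussianPDFReal]
        ring_nf
    _ = (√(2 * Real.pi))⁻¹ * 2 := by
        rw [integral_const_mul,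
          integral_comp_abs (f := fun x : ℝ => x * Real.exp (-(1 / 2) * x ^ 2)), hhalf, mul_one]
    _ = √(2 / Real.pi) := by
        rw [Real.sqrt_mul (by norm_num), Real.sqrt_div (by norm_num)]
        field_simp
        norm_num

theorem integral_abs_inner_stdGaussian (v : E) :
    ∫ w, |inner ℝ w v| ∂(stdGaussian E) = √(2 / Real.pi) * ‖v‖ := by
  rw [← integral_map (φ := fun w : E => inner ℝ w v) (f := fun x : ℝ => |x|) (by fun_prop)
    (by fun_prop), map_inner_stdGaussian, integral_map (by fun_prop) (by fun_prop)]
  simp_rw [abs_mul]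
  rw [integral_const_mul, integral_abs_gaussianReal, abs_norm, mul_comm]

theorem integral_norm_sq_stdGaussian :
    ∫ w : E, ‖w‖ ^ 2 ∂(stdGaussian E) = Module.finrank ℝ E := by
  have hvar : ∀ v : E, ∫ w : E, inner ℝ v w ^ 2 ∂(stdGaussian E) = ‖v‖ ^ 2 := fun v => by
    have h := variance_dual_stdGaussian (innerSL ℝ v)
    rw [variance_of_integral_eq_zero (by fun_prop) (integral_strongDual_stdGaussian _),
      innerSL_apply_norm] at h
    exact h
  have hint : ∀ v : E, Integrable (fun w : E => inner ℝ v w ^ 2) (stdGaussian E) := fun v =>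
    (IsGaussian.memLp_dual (stdGaussian E) (innerSL ℝ v) 2 (by simp)).integrable_sq
  let b := stdOrthonormalBasis ℝ E
  calc ∫ w : E, ‖w‖ ^ 2 ∂(stdGaussian E)
      = ∫ w : E, ∑ i, inner ℝ (b i) w ^ 2 ∂(stdGaussian E) := by
        simp_rw [b.sum_sq_inner_right]
    _ = ∑ i, ‖b i‖ ^ 2 := by
        rw [integral_finsetSum _ fun i _ => hint (b i)]
        simp_rw [hvar]
    _ = Module.finrank ℝ E := by simp

theorem integral_norm_stdGaussian_le :
    ∫ w : E, ‖w‖ ∂(stdGaussian E) ≤ √(Module.finrank ℝ E) := by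
  have hLp : MemLp (fun w : E => ‖w‖) 2 (stdGaussian E) :=
    (IsGaussian.memLp_id (stdGaussian E) 2 (by simp)).norm
  have hvar := variance_nonneg (fun w : E => ‖w‖) (stdGaussian E)
  rw [variance_eq_sub hLp] at hvar
  refine Real.le_sqrt_of_sq_le ?_
  rw [← integral_norm_sq_stdGaussian]
  simpa using hvar

instance isNegInvariant_stdGaussian : (stdGaussian E).IsNegInvariant :=
  ⟨stdGaussian_map (LinearIsometryEquiv.neg ℝ)⟩

theorem map_stdGaussian_of_inner_eq {F : Type*} [NormedAddCommGroup F] [InnerProductSpace ℝ F]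
    [FiniteDimensional ℝ F] [MeasurableSpace F] [BorelSpace F] {L : E → F} {J : F → E}
    (hL : Measurable L) (hLJ : ∀ w t, inner ℝ (L w) t = inner ℝ w (J t))
    (hJ : ∀ t, ‖J t‖ = ‖t‖) : (stdGaussian E).map L = stdGaussian F := by
  apply Measure.ext_of_charFun
  ext t
  rw [charFun_stdGaussian, ← hJ, ← charFun_stdGaussian, charFun_apply, charFun_apply,
    integral_map hL.aemeasurable (by fun_prop)]
  simp_rw [hLJ]

theorem map_fst_stdGaussian {F : Type*} [NormedAddCommGroup F] [InnerProductSpace ℝ F]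
    [FiniteDimensional ℝ F] [MeasurableSpace F] [BorelSpace F] :
    (stdGaussian (WithLp 2 (E × F))).map (fun w => w.fst) = stdGaussian E :=
  map_stdGaussian_of_inner_eq (J := fun x => WithLp.toLp 2 (x, 0)) (by fun_prop)
    (fun w x => by simp [WithLp.prod_inner_apply]) fun x => by simp

theorem map_snd_stdGaussian {F : Type*} [NormedAddCommGroup F] [InnerProductSpace ℝ F]
    [FiniteDimensional ℝ F] [MeasurableSpace F] [BorelSpace F] :
    (stdGaussian (WithLp 2 (E × F))).map (fun w => w.snd) = stdGaussian F :=
  map_stdGaussian_of_inner_eq (J := fun y => WithLp.toLp 2 (0, y)) (by fun_prop)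
    (fun w y => by simp [WithLp.prod_inner_apply]) fun y => by simp

theorem map_eval_stdGaussian {ι : Type*} [Fintype ι] {F : ι → Type*}
    [∀ i, NormedAddCommGroup (F i)] [∀ i, InnerProductSpace ℝ (F i)]
    [∀ i, FiniteDimensional ℝ (F i)] [∀ i, MeasurableSpace (F i)] [∀ i, BorelSpace (F i)]
    (i : ι) : (stdGaussian (PiLp 2 F)).map (fun w => w i) = stdGaussian (F i) := by
  classical
  refine map_stdGaussian_of_inner_eq (J := fun x => PiLp.single 2 i x) (by fun_prop)
    (fun w x => ?_) fun x => by simp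
  rw [PiLp.inner_apply, Finset.sum_eq_single i (fun j _ hj => by simp [hj]) (by simp)]
  simp

theorem map_sum_pi_stdGaussian (m : ℕ) :
    (Measure.pi fun _ : Fin m => stdGaussian E).map (fun a => ∑ k, a k) =
      (stdGaussian E).map (fun w => √(m : ℝ) • w) := by
  apply Measure.ext_of_charFun
  ext t
  have hnorm : ((‖√(m : ℝ) • t‖ : ℝ) : ℂ) ^ 2 = m * (‖t‖ : ℂ) ^ 2 := by
    rw [norm_smul, Real.norm_eq_abs, abs_of_nonneg (Real.sqrt_nonneg _)]
    push_cast
    rw [mul_pow, ← Complex.ofReal_pow, Real.sq_sqrt m.cast_nonneg, Complex.ofReal_natCast]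
  rw [charFun_map_smul, charFun_stdGaussian, charFun_apply,
    integral_map (by fun_prop) (by fun_prop)]
  simp_rw [sum_inner, Complex.ofReal_sum, Finset.sum_mul, Complex.exp_sum]
  rw [integral_fintype_prod_eq_prod (f := fun _ (x : E) =>
    Complex.exp ((inner ℝ x t : ℝ) * Complex.I))]
  simp_rw [← charFun_apply, charFun_stdGaussian]
  rw [Finset.prod_const, ← Complex.exp_nat_mul, Finset.card_univ, Fintype.card_fin, hnorm]
  congr 1
  ring

end StdGaussian

section Softmax

variable {I : Type*} [Fintype I]

/-- The free energy `log ∑ i, exp (f i)`, a smooth approximation of the maximum of `f`. -/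
noncomputable def logSumExp (f : I → ℝ) : ℝ :=
  Real.log (∑ i, Real.exp (f i))

/-- The Gibbs weights `exp (f i) / ∑ j, exp (f j)`, which form the gradient of `logSumExp`. -/
noncomputable def softmax (f : I → ℝ) (i : I) : ℝ :=
  Real.exp (f i) / ∑ j, Real.exp (f j)

@[fun_prop]
theorem measurable_logSumExp : Measurable (logSumExp : (I → ℝ) → ℝ) := by
  unfold logSumExp
  fun_prop

@[fun_prop]
theorem measurable_softmax (i : I) : Measurable fun f : I → ℝ => softmax f i := by
  unfold softmax
  fun_prop

theorem le_logSumExp (f : I → ℝ) (i : I) : f i ≤ logSumExp f := by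
  rw [logSumExp, ← Real.log_exp (f i)]
  exact Real.log_le_log (Real.exp_pos _)
    (Finset.single_le_sum (f := fun j => Real.exp (f j)) (fun j _ => (Real.exp_pos _).le)
      (Finset.mem_univ i))

theorem softmax_nonneg (f : I → ℝ) (i : I) : 0 ≤ softmax f i := by
  unfold softmax
  positivity

theorem sum_mul_sub_sum_nonneg {p : I → ℝ} (hp : ∀ i, 0 ≤ p i) (hp1 : ∑ i, p i = 1)
    {K : I → I → ℝ} (hK : ∀ i j, K i j + K j i ≤ K i i + K j j) :
    0 ≤ ∑ i, p i * (K i i - ∑ j, p j * K i j) := by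
  have hdiag : ∑ i, ∑ j, p i * p j * K i i = ∑ i, p i * K i i := by
    refine Finset.sum_congr rfl fun i _ => ?_
    rw [← Finset.sum_mul, ← Finset.mul_sum, hp1, mul_one]
  have hswap : ∀ k : I → I → ℝ, ∑ i, ∑ j, p i * p j * k j i = ∑ i, ∑ j, p i * p j * k i j := by
    intro k
    rw [Finset.sum_comm]
    simp_rw [mul_comm (p _) (p _)]
  have hsymm : ∑ i, p i * (K i i - ∑ j, p j * K i j) =
      (1 / 2) * ∑ i, ∑ j, p i * p j * (K i i + K j j - (K i j + K j i)) := by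
    simp_rw [mul_sub, mul_add, Finset.sum_sub_distrib, Finset.sum_add_distrib]
    rw [hswap fun i _ => K i i, hswap K, hdiag]
    simp_rw [Finset.mul_sum, mul_assoc]
    ring
  rw [hsymm]
  exact mul_nonneg (by norm_num) (Finset.sum_nonneg fun i _ => Finset.sum_nonneg fun j _ =>
    mul_nonneg (mul_nonneg (hp i) (hp j)) (sub_nonneg.2 (hK i j)))

variable [Nonempty I]

theorem sum_exp_pos (f : I → ℝ) : 0 < ∑ i, Real.exp (f i) :=
  Finset.sum_pos (fun _ _ => Real.exp_pos _) Finset.univ_nonempty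

theorem logSumExp_le {f : I → ℝ} {M : ℝ} (h : ∀ i, f i ≤ M) :
    logSumExp f ≤ M + Real.log (Fintype.card I) := by
  have hcard : (Fintype.card I : ℝ) ≠ 0 := by exact_mod_cast Fintype.card_ne_zero
  calc logSumExp f ≤ Real.log (∑ _i : I, Real.exp M) :=
        Real.log_le_log (sum_exp_pos f)
          (Finset.sum_le_sum fun i _ => Real.exp_le_exp.2 (h i))
    _ = M + Real.log (Fintype.card I) := by
        rw [Finset.sum_const, nsmul_eq_mul, Finset.card_univ,
          Real.log_mul hcard (Real.exp_pos M).ne', Real.log_exp, add_comm]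

theorem abs_logSumExp_le {f : I → ℝ} {M : ℝ} (h : ∀ i, |f i| ≤ M) :
    |logSumExp f| ≤ M + Real.log (Fintype.card I) := by
  refine abs_le.2 ⟨?_, logSumExp_le fun i => (abs_le.1 (h i)).2⟩
  obtain ⟨i⟩ := ‹Nonempty I›
  linarith [le_logSumExp f i, (abs_le.1 (h i)).1, Real.log_natCast_nonneg (Fintype.card I)]

theorem sum_softmax (f : I → ℝ) : ∑ i, softmax f i = 1 := by
  simp_rw [softmax, ← Finset.sum_div]
  exact div_self (sum_exp_pos f).ne'

theorem abs_softmax_le_one (f : I → ℝ) (i : I) : |softmax f i| ≤ 1 := by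
  rw [abs_of_nonneg (softmax_nonneg f i), ← sum_softmax f]
  exact Finset.single_le_sum (fun j _ => softmax_nonneg f j) (Finset.mem_univ i)

theorem abs_sum_softmax_mul_le (f : I → ℝ) {a : I → ℝ} {C : ℝ} (ha : ∀ i, |a i| ≤ C) :
    |∑ i, softmax f i * a i| ≤ C :=
  calc |∑ i, softmax f i * a i| ≤ ∑ i, softmax f i * C := by
        refine (Finset.abs_sum_le_sum_abs _ _).trans (Finset.sum_le_sum fun i _ => ?_)
        rw [abs_mul, abs_of_nonneg (softmax_nonneg f i)]
        exact mul_le_mul_of_nonneg_left (ha i) (softmax_nonneg f i)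
    _ = C := by rw [← Finset.sum_mul, sum_softmax, one_mul]

variable {f : ℝ → I → ℝ} {f' : I → ℝ} {t : ℝ}

theorem hasDerivAt_logSumExp (hf : ∀ i, HasDerivAt (fun s => f s i) (f' i) t) :
    HasDerivAt (fun s => logSumExp (f s)) (∑ i, softmax (f t) i * f' i) t := by
  have h := (HasDerivAt.fun_sum fun i (_ : i ∈ Finset.univ) => (hf i).exp).log
    (sum_exp_pos (f t)).ne'
  convert! h using 1
  simp only [softmax, div_mul_eq_mul_div, ← Finset.sum_div]

theorem hasDerivAt_softmax (hf : ∀ i, HasDerivAt (fun s => f s i) (f' i) t) (i : I) :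
    HasDerivAt (fun s => softmax (f s) i)
      (softmax (f t) i * (f' i - ∑ j, softmax (f t) j * f' j)) t := by
  have hsum := (sum_exp_pos (f t)).ne'
  have h := (hf i).exp.fun_div (HasDerivAt.fun_sum fun j (_ : j ∈ Finset.univ) => (hf j).exp) hsum
  convert! h using 1
  simp only [softmax, div_mul_eq_mul_div, ← Finset.sum_div]
  field_simp

end Softmax

section FreeEnergy

variable {Ω : Type*} [MeasurableSpace Ω] {μ : Measure Ω} {I : Type*}

theorem integrable_iSup [Finite I] {f : I → Ω → ℝ} (hf : ∀ i, Integrable (f i) μ) :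
    Integrable (fun ω => ⨆ i, f i ω) μ := by
  have := Fintype.ofFinite I
  refine (integrable_finsetSum Finset.univ fun i _ => (hf i).norm).mono'
    (AEMeasurable.iSup fun i => (hf i).aemeasurable).aestronglyMeasurable
    (ae_of_all _ fun ω => ?_)
  have hle : ∀ i, |f i ω| ≤ ∑ j, ‖f j ω‖ := fun i =>
    Finset.single_le_sum (f := fun j => ‖f j ω‖) (fun j _ => norm_nonneg _) (Finset.mem_univ i)
  rcases isEmpty_or_nonempty I with _ | ⟨⟨i⟩⟩
  · simp
  · have : Nonempty I := ⟨i⟩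
    exact abs_le.2 ⟨(neg_le_of_abs_le (hle i)).trans
      (le_ciSup (f := fun i => f i ω) (Set.finite_range _).bddAbove i),
      ciSup_le fun j => (le_abs_self _).trans (hle j)⟩

variable [Fintype I] [Nonempty I] {f : Ω → I → ℝ}

theorem integrable_logSumExp [IsFiniteMeasure μ] (hf : ∀ i, Integrable (fun ω => f ω i) μ) :
    Integrable (fun ω => logSumExp (f ω)) μ := by
  refine ((integrable_finsetSum Finset.univ fun i _ => (hf i).norm).add
    (integrable_const (Real.log (Fintype.card I)))).mono'
    (measurable_logSumExp.comp_aemeasurable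
      (aemeasurable_pi_lambda _ fun i => (hf i).aemeasurable)).aestronglyMeasurable
    (ae_of_all _ fun ω => abs_logSumExp_le fun i => ?_)
  exact Finset.single_le_sum (f := fun j => ‖f ω j‖) (fun j _ => norm_nonneg _)
    (Finset.mem_univ i)

theorem integral_iSup_le_integral_logSumExp [IsFiniteMeasure μ]
    (hf : ∀ i, Integrable (fun ω => f ω i) μ) :
    ∫ ω, ⨆ i, f ω i ∂μ ≤ ∫ ω, logSumExp (f ω) ∂μ :=
  integral_mono (integrable_iSup hf) (integrable_logSumExp hf) fun ω =>
    ciSup_le fun i => le_logSumExp (f ω) i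

theorem integral_logSumExp_le [IsProbabilityMeasure μ]
    (hf : ∀ i, Integrable (fun ω => f ω i) μ) :
    ∫ ω, logSumExp (f ω) ∂μ ≤ ∫ ω, ⨆ i, f ω i ∂μ + Real.log (Fintype.card I) := by
  calc ∫ ω, logSumExp (f ω) ∂μ ≤ ∫ ω, ((⨆ i, f ω i) + Real.log (Fintype.card I)) ∂μ :=
        integral_mono (integrable_logSumExp hf)
          ((integrable_iSup hf).add (integrable_const _)) fun ω =>
          logSumExp_le fun i => le_ciSup (Set.finite_range (f ω)).bddAbove i
    _ = ∫ ω, ⨆ i, f ω i ∂μ + Real.log (Fintype.card I) := by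
        rw [integral_add (integrable_iSup hf) (integrable_const _)]
        simp

end FreeEnergy

section Rotation

theorem norm_toLp_prod_le {E F : Type*} [NormedAddCommGroup E] [NormedAddCommGroup F] (x : E)
    (y : F) : ‖WithLp.toLp 2 (x, y)‖ ≤ ‖x‖ + ‖y‖ := by
  have h := norm_add_le (WithLp.toLp 2 (x, (0 : F))) (WithLp.toLp 2 ((0 : E), y))
  rwa [← WithLp.toLp_add, Prod.mk_add_mk, add_zero, zero_add, WithLp.norm_toLp_fst,
    WithLp.norm_toLp_snd] at h

variable {E F : Type*} [NormedAddCommGroup E] [InnerProductSpace ℝ E] [NormedAddCommGroup F]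
  [InnerProductSpace ℝ F]

theorem hasDerivAt_toLp_cos_smul_sin_smul (x : E) (y : F) (θ : ℝ) :
    HasDerivAt (fun θ => WithLp.toLp 2 (Real.cos θ • x, Real.sin θ • y))
      (WithLp.toLp 2 (-Real.sin θ • x, Real.cos θ • y)) θ :=
  (WithLp.prodContinuousLinearEquiv 2 ℝ E F).symm.hasFDerivAt.comp_hasDerivAt θ
    (((Real.hasDerivAt_cos θ).smul_const x).prodMk ((Real.hasDerivAt_sin θ).smul_const y))

theorem norm_toLp_sin_smul_cos_smul_le (x : E) (y : F) (θ : ℝ) :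
    ‖WithLp.toLp 2 (-Real.sin θ • x, Real.cos θ • y)‖ ≤ ‖x‖ + ‖y‖ := by
  refine (norm_toLp_prod_le _ _).trans ?_
  rw [norm_smul, norm_smul, norm_neg]
  exact add_le_add (mul_le_of_le_one_left (norm_nonneg x) (Real.abs_sin_le_one θ))
    (mul_le_of_le_one_left (norm_nonneg y) (Real.abs_cos_le_one θ))

theorem inner_toLp_sin_smul_cos_smul (x : E) (y : F) (θ : ℝ) :
    inner ℝ (WithLp.toLp 2 (-Real.sin θ • x, Real.cos θ • y))
        (WithLp.toLp 2 (Real.cos θ • x, Real.sin θ • y)) =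
      Real.sin θ * Real.cos θ * (‖y‖ ^ 2 - ‖x‖ ^ 2) := by
  simp only [WithLp.prod_inner_apply, real_inner_smul_left, real_inner_smul_right,
    real_inner_self_eq_norm_sq]
  ring

end Rotation

section SudakovFernique

variable {E : Type*} [NormedAddCommGroup E] [InnerProductSpace ℝ E] [FiniteDimensional ℝ E]
  [MeasurableSpace E] [BorelSpace E] {I : Type*} [Fintype I] [Nonempty I]

theorem integrable_softmax_inner (z : I → E) (i : I) :
    Integrable (fun w => softmax (fun k => inner ℝ w (z k)) i) (stdGaussian E) :=
  (integrable_const 1).mono' (Measurable.aestronglyMeasurable (by fun_prop))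
    (ae_of_all _ fun _ => abs_softmax_le_one _ i)

theorem integrable_softmax_inner_mul (z : I → E) (i : I) {g : E → ℝ}
    (hg : Integrable g (stdGaussian E)) :
    Integrable (fun w => softmax (fun k => inner ℝ w (z k)) i * g w) (stdGaussian E) :=
  hg.bdd_mul (Measurable.aestronglyMeasurable (by fun_prop))
    (ae_of_all _ fun _ => abs_softmax_le_one _ i)

theorem integrable_inner_sub_sum_softmax (z : I → E) (i : I) (v : E) :
    Integrable (fun w => inner ℝ v (z i) -
      ∑ j, softmax (fun k => inner ℝ w (z k)) j * inner ℝ v (z j)) (stdGaussian E) :=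
  (integrable_const _).sub (integrable_finsetSum _ fun j _ =>
    (integrable_softmax_inner z j).mul_const _)

theorem integral_softmax_mul_inner (z : I → E) (i : I) (v : E) :
    ∫ w, softmax (fun k => inner ℝ w (z k)) i * inner ℝ w v ∂(stdGaussian E) =
      ∫ w, softmax (fun k => inner ℝ w (z k)) i * (inner ℝ v (z i) -
        ∑ j, softmax (fun k => inner ℝ w (z k)) j * inner ℝ v (z j)) ∂(stdGaussian E) := by
  have hline : ∀ w k, HasDerivAt (fun s : ℝ => inner ℝ (w + s • v) (z k)) (inner ℝ v (z k)) 0 := by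
    intro w k
    simpa [inner_add_left, real_inner_smul_left] using
      ((hasDerivAt_id (0 : ℝ)).mul_const (inner ℝ v (z k))).const_add (inner ℝ w (z k))
  simp_rw [mul_comm _ (inner ℝ _ v)]
  refine integral_inner_mul_stdGaussian (fun w => ?_) (integrable_softmax_inner z i)
    (integrable_softmax_inner_mul z i (integrable_inner_sub_sum_softmax z i v)) ?_
  · simpa [HasLineDerivAt] using hasDerivAt_softmax (hline w) i
  · simpa only [mul_comm] using
      integrable_softmax_inner_mul z i (integrable_inner_stdGaussian v)

theorem integral_sum_softmax_mul_inner_nonneg {z v : I → E}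
    (h : ∀ i j, 0 ≤ inner ℝ (v i - v j) (z i - z j)) :
    0 ≤ ∫ w, ∑ i, softmax (fun k => inner ℝ w (z k)) i * inner ℝ w (v i) ∂(stdGaussian E) := by
  rw [integral_finsetSum _ fun i _ =>
    integrable_softmax_inner_mul z i (integrable_inner_stdGaussian (v i))]
  simp_rw [integral_softmax_mul_inner]
  rw [← integral_finsetSum _ fun i _ =>
    integrable_softmax_inner_mul z i (integrable_inner_sub_sum_softmax z i (v i))]
  refine integral_nonneg fun w => sum_mul_sub_sum_nonneg (K := fun i j => inner ℝ (v i) (z j))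
    (softmax_nonneg _) (sum_softmax _) fun i j => ?_
  have hij := h i j
  simp only [inner_sub_left, inner_sub_right] at hij
  linarith

theorem hasDerivAt_integral_logSumExp_inner {z v : ℝ → I → E} {C : ℝ}
    (hz : ∀ t i, HasDerivAt (fun s => z s i) (v t i) t) (hv : ∀ t i, ‖v t i‖ ≤ C) (t : ℝ) :
    HasDerivAt (fun s => ∫ w, logSumExp (fun i => inner ℝ w (z s i)) ∂(stdGaussian E))
      (∫ w, ∑ i, softmax (fun k => inner ℝ w (z t k)) i * inner ℝ w (v t i) ∂(stdGaussian E))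
      t := by
  have hint : ∀ s, Integrable (fun w => logSumExp fun i => inner ℝ w (z s i)) (stdGaussian E) :=
    fun s => integrable_logSumExp fun i => integrable_inner_stdGaussian _
  have hint' : Integrable (fun w => ∑ i, softmax (fun k => inner ℝ w (z t k)) i *
      inner ℝ w (v t i)) (stdGaussian E) :=
    integrable_finsetSum _ fun i _ =>
      integrable_softmax_inner_mul (z t) i (integrable_inner_stdGaussian (v t i))
  have hbound : ∀ w s, ‖∑ i, softmax (fun k => inner ℝ w (z s k)) i * inner ℝ w (v s i)‖ ≤
      ‖w‖ * C := fun w s => abs_sum_softmax_mul_le _ fun i =>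
    (abs_real_inner_le_norm _ _).trans (mul_le_mul_of_nonneg_left (hv s i) (norm_nonneg w))
  have hderiv : ∀ w s, HasDerivAt (fun s => logSumExp fun i => inner ℝ w (z s i))
      (∑ i, softmax (fun k => inner ℝ w (z s k)) i * inner ℝ w (v s i)) s := fun w s =>
    hasDerivAt_logSumExp (f := fun s i => inner ℝ w (z s i)) fun i => by
      simpa using (hasDerivAt_const s w).inner ℝ (hz s i)
  exact (hasDerivAt_integral_of_dominated_loc_of_deriv_le Filter.univ_mem
    (Filter.Eventually.of_forall fun s => (hint s).aestronglyMeasurable) (hint t)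
    hint'.aestronglyMeasurable (ae_of_all _ fun w s _ => hbound w s)
    (integrable_norm_stdGaussian.mul_const C) (ae_of_all _ fun w s _ => hderiv w s)).2

theorem monotoneOn_integral_logSumExp_inner {z v : ℝ → I → E} {C : ℝ} {S : Set ℝ}
    (hS : Convex ℝ S) (hz : ∀ t i, HasDerivAt (fun s => z s i) (v t i) t)
    (hv : ∀ t i, ‖v t i‖ ≤ C)
    (h : ∀ t ∈ S, ∀ i j, 0 ≤ inner ℝ (v t i - v t j) (z t i - z t j)) :
    MonotoneOn (fun s => ∫ w, logSumExp (fun i => inner ℝ w (z s i)) ∂(stdGaussian E)) S :=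
  monotoneOn_of_hasDerivWithinAt_nonneg hS
    (fun t _ => (hasDerivAt_integral_logSumExp_inner hz hv t).continuousAt.continuousWithinAt)
    (fun t _ => (hasDerivAt_integral_logSumExp_inner hz hv t).hasDerivWithinAt)
    fun t ht => integral_sum_softmax_mul_inner_nonneg (h t (interior_subset ht))

variable {F : Type*} [NormedAddCommGroup F] [InnerProductSpace ℝ F] [FiniteDimensional ℝ F]
  [MeasurableSpace F] [BorelSpace F]

theorem integral_logSumExp_inner_le_of_norm_sub_le {x : I → E} {y : I → F}
    (h : ∀ i j, ‖x i - x j‖ ≤ ‖y i - y j‖) :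
    ∫ w, logSumExp (fun i => inner ℝ w (x i)) ∂(stdGaussian E) ≤
      ∫ w, logSumExp (fun i => inner ℝ w (y i)) ∂(stdGaussian F) := by
  let z : ℝ → I → WithLp 2 (E × F) := fun θ i =>
    WithLp.toLp 2 (Real.cos θ • x i, Real.sin θ • y i)
  let v : ℝ → I → WithLp 2 (E × F) := fun θ i =>
    WithLp.toLp 2 (-Real.sin θ • x i, Real.cos θ • y i)
  have hv : ∀ θ i, ‖v θ i‖ ≤ ∑ j, (‖x j‖ + ‖y j‖) := fun θ i =>
    (norm_toLp_sin_smul_cos_smul_le (x i) (y i) θ).trans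
      (Finset.single_le_sum (f := fun j => ‖x j‖ + ‖y j‖) (fun j _ => by positivity)
        (Finset.mem_univ i))
  have hinner : ∀ θ ∈ Set.Icc 0 (Real.pi / 2), ∀ i j,
      0 ≤ inner ℝ (v θ i - v θ j) (z θ i - z θ j) := by
    intro θ hθ i j
    have hsin : 0 ≤ Real.sin θ :=
      Real.sin_nonneg_of_nonneg_of_le_pi hθ.1 (by linarith [hθ.2, Real.pi_pos])
    have hcos : 0 ≤ Real.cos θ :=
      Real.cos_nonneg_of_neg_pi_div_two_le_of_le (by linarith [hθ.1, Real.pi_pos]) hθ.2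
    simp only [z, v, ← WithLp.toLp_sub, Prod.mk_sub_mk, ← smul_sub,
      inner_toLp_sin_smul_cos_smul]
    exact mul_nonneg (mul_nonneg hsin hcos)
      (sub_nonneg.2 (pow_le_pow_left₀ (norm_nonneg _) (h i j) 2))
  have hmono := monotoneOn_integral_logSumExp_inner (convex_Icc _ _)
    (fun θ i => hasDerivAt_toLp_cos_smul_sin_smul (x i) (y i) θ) hv hinner
    (Set.left_mem_Icc.2 (by positivity)) (Set.right_mem_Icc.2 (by positivity)) (by positivity)
  rw [← map_fst_stdGaussian (E := E) (F := F), ← map_snd_stdGaussian (E := E) (F := F),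
    integral_map (by fun_prop) (Measurable.aestronglyMeasurable (by fun_prop)),
    integral_map (by fun_prop) (Measurable.aestronglyMeasurable (by fun_prop))]
  simpa [z, WithLp.prod_inner_apply] using hmono

theorem integral_iSup_inner_le_of_norm_sub_le {J : Type*} [Finite J] {x : J → E}
    {y : J → F} (h : ∀ i j, ‖x i - x j‖ ≤ ‖y i - y j‖) :
    ∫ w, ⨆ i, inner ℝ w (x i) ∂(stdGaussian E) ≤ ∫ w, ⨆ i, inner ℝ w (y i) ∂(stdGaussian F) := by
  rcases isEmpty_or_nonempty J with _ | _
  · simp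
  have := Fintype.ofFinite J
  -- Scaling by a large `β` makes the additive error `log (card J)` of the free energy negligible.
  have hscale : ∀ β : ℝ, 0 ≤ β → β * ∫ w, ⨆ i, inner ℝ w (x i) ∂(stdGaussian E) ≤
      β * ∫ w, ⨆ i, inner ℝ w (y i) ∂(stdGaussian F) + Real.log (Fintype.card J) := by
    intro β hβ
    have hfree := integral_logSumExp_inner_le_of_norm_sub_le (x := fun i => β • x i)
      (y := fun i => β • y i) fun i j => by
        rw [← smul_sub, ← smul_sub, norm_smul, norm_smul]
        exact mul_le_mul_of_nonneg_left (h i j) (norm_nonneg β)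
    have hle := ((integral_iSup_le_integral_logSumExp fun i =>
      integrable_inner_stdGaussian (β • x i)).trans hfree).trans
      (integral_logSumExp_le fun i => integrable_inner_stdGaussian (β • y i))
    simpa only [real_inner_smul_right, ← Real.mul_iSup_of_nonneg hβ, integral_const_mul] using hle
  by_contra! hlt
  rw [← sub_pos] at hlt
  have hlog := Real.log_natCast_nonneg (Fintype.card J)
  have hβ := hscale ((Real.log (Fintype.card J) + 1) /
    (∫ w, ⨆ i, inner ℝ w (x i) ∂(stdGaussian E) - ∫ w, ⨆ i, inner ℝ w (y i) ∂(stdGaussian F)))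
    (div_pos (add_pos_of_nonneg_of_pos hlog one_pos) hlt).le
  rw [← sub_le_iff_le_add', ← mul_sub, div_mul_cancel₀ _ hlt.ne'] at hβ
  linarith

end SudakovFernique

section GaussianWidth

theorem integral_le_of_forall_finite_integral_iSup_le {Ω : Type*} [MeasurableSpace Ω]
    {μ : Measure Ω} {α : Type*} [PseudoMetricSpace α] {K : Set α} (hK : TotallyBounded K)
    (hne : K.Nonempty) {f : α → Ω → ℝ} {X L : Ω → ℝ} {C : ℝ}
    (hf : ∀ x ∈ K, Integrable (f x) μ) (hX : Integrable X μ) (hL : Integrable L μ)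
    (hfL : ∀ᵐ ω ∂μ, ∀ x ∈ K, ∀ y ∈ K, f x ω ≤ f y ω + L ω * dist x y)
    (hXf : ∀ᵐ ω ∂μ, ∀ b, (∀ x ∈ K, f x ω ≤ b) → X ω ≤ b)
    (hC : ∀ F ⊆ K, F.Finite → F.Nonempty → ∫ ω, ⨆ x : F, f x ω ∂μ ≤ C) :
    ∫ ω, X ω ∂μ ≤ C := by
  have hnet : ∀ ε > 0, ∫ ω, X ω ∂μ ≤ C + (∫ ω, |L ω| ∂μ) * ε := by
    intro ε hε
    obtain ⟨F, hFK, hF, hcover⟩ := Metric.finite_approx_of_totallyBounded hK ε hε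
    have hFne : F.Nonempty := by
      obtain ⟨x, hx⟩ := hne
      obtain ⟨y, hy, -⟩ := Set.mem_iUnion₂.1 (hcover hx)
      exact ⟨y, hy⟩
    have := hF.to_subtype
    have hsup : Integrable (fun ω => ⨆ x : F, f x ω) μ :=
      integrable_iSup fun x : F => hf x (hFK x.2)
    have hle : ∀ᵐ ω ∂μ, X ω ≤ (⨆ x : F, f x ω) + |L ω| * ε := by
      filter_upwards [hfL, hXf] with ω hω hXω
      refine hXω _ fun x hx => ?_
      obtain ⟨y, hy, hxy⟩ := Set.mem_iUnion₂.1 (hcover hx)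
      have hLε : L ω * dist x y ≤ |L ω| * ε :=
        mul_le_mul (le_abs_self _) (Metric.mem_ball.1 hxy).le dist_nonneg (abs_nonneg _)
      exact (hω x hx y (hFK hy)).trans (add_le_add
        (le_ciSup (f := fun y : F => f y ω) (Set.finite_range _).bddAbove ⟨y, hy⟩) hLε)
    calc ∫ ω, X ω ∂μ ≤ ∫ ω, ((⨆ x : F, f x ω) + |L ω| * ε) ∂μ :=
          integral_mono_ae hX (hsup.add (hL.abs.mul_const ε)) hle
      _ = ∫ ω, ⨆ x : F, f x ω ∂μ + (∫ ω, |L ω| ∂μ) * ε := by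
          rw [integral_add hsup (hL.abs.mul_const ε), integral_mul_const]
      _ ≤ C + (∫ ω, |L ω| ∂μ) * ε := add_le_add (hC F hFK hF hFne) le_rfl
  have hlim : Filter.Tendsto (fun ε => C + (∫ ω, |L ω| ∂μ) * ε) (nhdsWithin 0 (Set.Ioi 0))
      (nhds C) := by
    have hcont : Continuous fun ε => C + (∫ ω, |L ω| ∂μ) * ε := by fun_prop
    simpa using (hcont.tendsto 0).mono_left nhdsWithin_le_nhds
  exact ge_of_tendsto hlim (Filter.mem_of_superset self_mem_nhdsWithin hnet)

variable {E : Type*} [NormedAddCommGroup E] [InnerProductSpace ℝ E] {K : Set E} {g : E}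

/-- The support function `g ↦ sup {⟨g, x⟩ : x ∈ K}` of a set `K`; its values are meaningful when
`K` is nonempty and bounded. -/
noncomputable def supportFunction (K : Set E) (g : E) : ℝ := ⨆ x : K, inner ℝ g x

theorem inner_le_supportFunction (hK : Bornology.IsBounded K) (g : E) {x : E} (hx : x ∈ K) :
    inner ℝ g x ≤ supportFunction K g := by
  obtain ⟨C, hC⟩ := hK.exists_norm_le
  have hbdd : BddAbove (Set.range fun x : K => inner ℝ g (x : E)) := by
    refine ⟨‖g‖ * C, ?_⟩
    rintro _ ⟨x, rfl⟩
    exact (real_inner_le_norm _ _).trans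
      (mul_le_mul_of_nonneg_left (hC x x.2) (norm_nonneg g))
  exact le_ciSup hbdd ⟨x, hx⟩

theorem supportFunction_le (hne : K.Nonempty) {r : ℝ} (h : ∀ x ∈ K, inner ℝ g x ≤ r) :
    supportFunction K g ≤ r :=
  have := hne.to_subtype
  ciSup_le fun x : K => h x x.2

theorem supportFunction_zero (K : Set E) : supportFunction K 0 = 0 := by
  simp [supportFunction]

theorem supportFunction_smul (K : Set E) {c : ℝ} (hc : 0 ≤ c) (g : E) :
    supportFunction K (c • g) = c * supportFunction K g := by
  simp only [supportFunction, real_inner_smul_left, Real.mul_iSup_of_nonneg hc]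

theorem exists_lipschitzWith_supportFunction (hK : Bornology.IsBounded K) :
    ∃ C, LipschitzWith C (supportFunction K) := by
  rcases K.eq_empty_or_nonempty with rfl | hne
  · exact ⟨0, by simp [supportFunction]⟩
  obtain ⟨C, hC⟩ := hK.exists_norm_le
  refine ⟨C.toNNReal, LipschitzWith.of_le_add_mul _ fun g g' => supportFunction_le hne
    fun x hx => ?_⟩
  have hdiff : inner ℝ (g - g') x ≤ C.toNNReal * dist g g' := by
    rw [dist_eq_norm, mul_comm]
    exact (real_inner_le_norm _ _).trans (mul_le_mul_of_nonneg_left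
      ((hC x hx).trans (Real.le_coe_toNNReal C)) (norm_nonneg _))
  rw [inner_sub_left] at hdiff
  linarith [inner_le_supportFunction hK g' hx]

theorem continuous_supportFunction (hK : Bornology.IsBounded K) :
    Continuous (supportFunction K) :=
  let ⟨_, hC⟩ := exists_lipschitzWith_supportFunction hK
  hC.continuous

variable [FiniteDimensional ℝ E] [MeasurableSpace E] [BorelSpace E]

theorem integrable_supportFunction (hK : Bornology.IsBounded K) :
    Integrable (supportFunction K) (stdGaussian E) := by
  obtain ⟨C, hC⟩ := exists_lipschitzWith_supportFunction hK
  refine (integrable_norm_stdGaussian.const_mul (C : ℝ)).mono'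
    hC.continuous.aestronglyMeasurable (ae_of_all _ fun g => ?_)
  simpa [supportFunction_zero] using hC.dist_le_mul g 0

/-- The Gaussian width `𝔼 sup {⟨g, x⟩ : x ∈ K}` of a set `K`, for a standard Gaussian vector
`g`. -/
noncomputable def gaussianWidth (K : Set E) : ℝ := ∫ g, supportFunction K g ∂(stdGaussian E)

theorem integral_supportFunction_sum_pi (hK : Bornology.IsBounded K) (m : ℕ) :
    ∫ a : Fin m → E, supportFunction K (∑ k, a k) ∂(Measure.pi fun _ => stdGaussian E) =
      √m * gaussianWidth K := by
  have hcont := continuous_supportFunction hK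
  rw [← integral_map (φ := fun a : Fin m → E => ∑ k, a k) (by fun_prop)
    hcont.aestronglyMeasurable, map_sum_pi_stdGaussian,
    integral_map (by fun_prop) hcont.aestronglyMeasurable]
  simp only [supportFunction_smul K (Real.sqrt_nonneg _), integral_const_mul, gaussianWidth]

theorem integrable_supportFunction_sum_pi (hK : Bornology.IsBounded K) (m : ℕ) :
    Integrable (fun a : Fin m → E => supportFunction K (∑ k, a k))
      (Measure.pi fun _ => stdGaussian E) := by
  have hcont := continuous_supportFunction hK
  have hscaled : Integrable (supportFunction K)
      ((stdGaussian E).map fun w => √(m : ℝ) • w) := by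
    rw [integrable_map_measure hcont.aestronglyMeasurable (by fun_prop)]
    simpa only [Function.comp_def, supportFunction_smul K (Real.sqrt_nonneg _)] using
      (integrable_supportFunction hK).const_mul √(m : ℝ)
  rw [← map_sum_pi_stdGaussian] at hscaled
  exact hscaled.comp_measurable (by fun_prop)

theorem gaussianWidth_range_le_of_norm_sub_le {F : Type*} [NormedAddCommGroup F]
    [InnerProductSpace ℝ F] [FiniteDimensional ℝ F] [MeasurableSpace F] [BorelSpace F]
    {I : Type*} [Nonempty I] {x : I → E} {y : I → F}
    (hy : Bornology.IsBounded (Set.range y)) (h : ∀ i j, ‖x i - x j‖ ≤ ‖y i - y j‖) :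
    gaussianWidth (Set.range x) ≤ gaussianWidth (Set.range y) := by
  have hx : Bornology.IsBounded (Set.range x) := by
    obtain ⟨C, hC⟩ := Metric.isBounded_range_iff.1 hy
    refine Metric.isBounded_range_iff.2 ⟨C, fun i j => ?_⟩
    rw [dist_eq_norm]
    exact (h i j).trans (dist_eq_norm (y i) (y j) ▸ hC i j)
  refine integral_le_of_forall_finite_integral_iSup_le
    (hx.isCompact_closure.totallyBounded.subset subset_closure) (Set.range_nonempty x)
    (f := fun x w => inner ℝ w x) (fun x _ => integrable_inner_stdGaussian x)
    (integrable_supportFunction hx) integrable_norm_stdGaussian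
    (ae_of_all _ fun w u _ v _ => ?_)
    (ae_of_all _ fun w b hb => supportFunction_le (Set.range_nonempty x) hb)
    fun S hS hSfin hSne => ?_
  · rw [dist_eq_norm, ← sub_le_iff_le_add', ← inner_sub_right]
    exact real_inner_le_norm _ _
  have := hSfin.to_subtype
  have := hSne.to_subtype
  choose i hi using fun s : S => hS s.2
  simp_rw [← hi]
  exact (integral_iSup_inner_le_of_norm_sub_le fun s t => h (i s) (i t)).trans
    (integral_mono (integrable_iSup fun s => integrable_inner_stdGaussian (y (i s)))
      (integrable_supportFunction hy) fun w => ciSup_le fun s =>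
      inner_le_supportFunction hy w (Set.mem_range_self (i s)))

end GaussianWidth

section Symmetrization

variable {I : Type*}

theorem integral_iSup_sub_eq_of_odd {V : Type*} [AddGroup V] [MeasurableSpace V]
    [MeasurableNeg V] {μ : Measure V} [μ.IsNegInvariant] {f : I → V → ℝ}
    (hodd : ∀ i a, f i (-a) = -f i a) (B : I → ℝ) :
    ∫ a, ⨆ i, (B i - f i a) ∂μ = ∫ a, ⨆ i, (B i + f i a) ∂μ := by
  rw [← integral_neg_eq_self (fun a => ⨆ i, (B i + f i a)) μ]
  simp only [hodd, sub_eq_add_neg]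

variable [Finite I]

theorem iSup_add_le_iSup_add_iSup [Nonempty I] (f g : I → ℝ) :
    ⨆ i, (f i + g i) ≤ (⨆ i, f i) + ⨆ i, g i :=
  ciSup_le fun i => add_le_add (le_ciSup (Set.finite_range f).bddAbove i)
    (le_ciSup (Set.finite_range g).bddAbove i)

theorem iSup_add_abs_add_iSup_sub_abs_le [Nonempty I] (B x : I → ℝ) :
    (⨆ i, (B i + |x i|)) + (⨆ i, (B i - |x i|)) ≤ (⨆ i, (B i + x i)) + ⨆ i, (B i - x i) := by
  obtain ⟨i, hi⟩ := exists_eq_ciSup_of_finite (f := fun i => B i + |x i|)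
  obtain ⟨j, hj⟩ := exists_eq_ciSup_of_finite (f := fun i => B i - |x i|)
  rw [← hi, ← hj]
  have hp : ∀ k, B k + x k ≤ ⨆ i, (B i + x i) :=
    le_ciSup (f := fun i => B i + x i) (Set.finite_range _).bddAbove
  have hm : ∀ k, B k - x k ≤ ⨆ i, (B i - x i) :=
    le_ciSup (f := fun i => B i - x i) (Set.finite_range _).bddAbove
  rcases abs_cases (x i) with ⟨h, -⟩ | ⟨h, -⟩
  · linarith [hp i, hm j, le_abs_self (x j)]
  · linarith [hm i, hp j, neg_le_abs (x j)]

theorem iSup_integral_le_integral_iSup [Nonempty I] {Ω : Type*} [MeasurableSpace Ω]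
    {μ : Measure Ω} {f : I → Ω → ℝ} (hf : ∀ i, Integrable (f i) μ) :
    ⨆ i, ∫ ω, f i ω ∂μ ≤ ∫ ω, ⨆ i, f i ω ∂μ :=
  ciSup_le fun i => integral_mono (hf i) (integrable_iSup hf) fun ω =>
    le_ciSup (f := fun i => f i ω) (Set.finite_range _).bddAbove i

section Odd

variable {V : Type*} [MeasurableSpace V] {μ : Measure V} {f : I → V → ℝ}
  [Nonempty I] [IsProbabilityMeasure μ]

theorem integral_iSup_add_integral_abs_sub_abs_le (hf : ∀ i, Integrable (f i) μ) (B : I → ℝ) :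
    ∫ a, ⨆ i, (2 * B i + (∫ a', |f i a'| ∂μ - |f i a|)) ∂μ ≤
      ∫ a, ⨆ i, (B i + f i a) ∂μ + ∫ a, ⨆ i, (B i - f i a) ∂μ := by
  have hplus_abs : Integrable (fun a => ⨆ i, (B i + |f i a|)) μ :=
    integrable_iSup fun i => (integrable_const (B i)).add (hf i).abs
  have hminus_abs : Integrable (fun a => ⨆ i, (B i - |f i a|)) μ :=
    integrable_iSup fun i => (integrable_const (B i)).sub (hf i).abs
  have hplus : Integrable (fun a => ⨆ i, (B i + f i a)) μ :=
    integrable_iSup fun i => (integrable_const (B i)).add (hf i)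
  have hminus : Integrable (fun a => ⨆ i, (B i - f i a)) μ :=
    integrable_iSup fun i => (integrable_const (B i)).sub (hf i)
  -- Jensen produces a second supremum over the same sample, so that the pointwise inequality for
  -- the pair of suprema applies.
  have hjensen : ⨆ i, (B i + ∫ a', |f i a'| ∂μ) ≤ ∫ a, ⨆ i, (B i + |f i a|) ∂μ := by
    refine le_of_eq_of_le (congrArg iSup (funext fun i => ?_))
      (iSup_integral_le_integral_iSup fun i => (integrable_const (B i)).add (hf i).abs)
    simp [integral_add (integrable_const _) (hf i).abs]
  calc ∫ a, ⨆ i, (2 * B i + (∫ a', |f i a'| ∂μ - |f i a|)) ∂μ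
      ≤ ∫ a, ((⨆ i, (B i + ∫ a', |f i a'| ∂μ)) + ⨆ i, (B i - |f i a|)) ∂μ := by
        refine integral_mono (integrable_iSup fun i => (integrable_const _).add
          ((integrable_const _).sub (hf i).abs)) ((integrable_const _).add hminus_abs)
          fun a => le_of_eq_of_le ?_ (iSup_add_le_iSup_add_iSup _ _)
        exact congrArg iSup (funext fun i => by ring)
    _ = (⨆ i, (B i + ∫ a', |f i a'| ∂μ)) + ∫ a, ⨆ i, (B i - |f i a|) ∂μ := by
        rw [integral_add (integrable_const _) hminus_abs]
        simp
    _ ≤ ∫ a, ⨆ i, (B i + |f i a|) ∂μ + ∫ a, ⨆ i, (B i - |f i a|) ∂μ :=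
        add_le_add_left hjensen _
    _ = ∫ a, ((⨆ i, (B i + |f i a|)) + ⨆ i, (B i - |f i a|)) ∂μ :=
        (integral_add hplus_abs hminus_abs).symm
    _ ≤ ∫ a, ((⨆ i, (B i + f i a)) + ⨆ i, (B i - f i a)) ∂μ :=
        integral_mono (hplus_abs.add hminus_abs) (hplus.add hminus) fun a =>
          iSup_add_abs_add_iSup_sub_abs_le B fun i => f i a
    _ = ∫ a, ⨆ i, (B i + f i a) ∂μ + ∫ a, ⨆ i, (B i - f i a) ∂μ :=
        integral_add hplus hminus

theorem integral_iSup_add_integral_abs_sub_abs_le_of_odd [AddGroup V] [MeasurableNeg V]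
    [μ.IsNegInvariant] (hf : ∀ i, Integrable (f i) μ) (hodd : ∀ i a, f i (-a) = -f i a)
    (B : I → ℝ) :
    ∫ a, ⨆ i, (B i + (∫ a', |f i a'| ∂μ - |f i a|)) ∂μ ≤ ∫ a, ⨆ i, (B i + 2 * f i a) ∂μ := by
  have hsymm := integral_iSup_add_integral_abs_sub_abs_le hf fun i => B i / 2
  rw [integral_iSup_sub_eq_of_odd hodd, ← two_mul, ← integral_const_mul] at hsymm
  simp only [Real.mul_iSup_of_nonneg zero_le_two, mul_add] at hsymm
  simpa only [mul_div_cancel₀ _ (two_ne_zero' ℝ)] using hsymm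

end Odd

section Tensorization

variable {α β : Type*} [MeasurableSpace α] [MeasurableSpace β] {μ : Measure α} {ν : Measure β}
  [IsFiniteMeasure μ] [IsFiniteMeasure ν] {f g : I → α → ℝ} {f' g' : I → β → ℝ}

theorem integral_iSup_prod_le (hf : ∀ i, Integrable (f i) μ) (hg : ∀ i, Integrable (g i) μ)
    (hf' : ∀ i, Integrable (f' i) ν) (hg' : ∀ i, Integrable (g' i) ν)
    (hfg : ∀ B : I → ℝ, ∫ a, ⨆ i, (B i + f i a) ∂μ ≤ ∫ a, ⨆ i, (B i + g i a) ∂μ)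
    (hfg' : ∀ B : I → ℝ, ∫ b, ⨆ i, (B i + f' i b) ∂ν ≤ ∫ b, ⨆ i, (B i + g' i b) ∂ν)
    (B : I → ℝ) :
    ∫ p, ⨆ i, (B i + (f i p.1 + f' i p.2)) ∂(μ.prod ν) ≤
      ∫ p, ⨆ i, (B i + (g i p.1 + g' i p.2)) ∂(μ.prod ν) := by
  have hint : ∀ {u : I → α → ℝ} {v : I → β → ℝ}, (∀ i, Integrable (u i) μ) →
      (∀ i, Integrable (v i) ν) →
      Integrable (fun p : α × β => ⨆ i, (B i + (u i p.1 + v i p.2))) (μ.prod ν) := fun hu hv =>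
    integrable_iSup fun i =>
      (integrable_const (B i)).add (((hu i).comp_fst ν).add ((hv i).comp_snd μ))
  calc ∫ p, ⨆ i, (B i + (f i p.1 + f' i p.2)) ∂(μ.prod ν)
      ≤ ∫ p, ⨆ i, (B i + (f i p.1 + g' i p.2)) ∂(μ.prod ν) := by
        rw [integral_prod _ (hint hf hf'), integral_prod _ (hint hf hg')]
        refine integral_mono (hint hf hf').integral_prod_left (hint hf hg').integral_prod_left
          fun a => ?_
        simpa only [add_assoc] using hfg' fun i => B i + f i a
    _ ≤ ∫ p, ⨆ i, (B i + (g i p.1 + g' i p.2)) ∂(μ.prod ν) := by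
        rw [integral_prod_symm _ (hint hf hg'), integral_prod_symm _ (hint hg hg')]
        refine integral_mono (hint hf hg').integral_prod_right (hint hg hg').integral_prod_right
          fun b => ?_
        simpa only [add_assoc, add_comm (g' _ _)] using hfg fun i => B i + g' i b

theorem integral_pi_finSucc {μ : Measure α} [SigmaFinite μ] {m : ℕ} (F : (Fin (m + 1) → α) → ℝ) :
    ∫ a, F a ∂(Measure.pi fun _ => μ) =
      ∫ p : α × (Fin m → α), F (Fin.cons p.1 p.2) ∂(μ.prod (Measure.pi fun _ => μ)) := by
  rw [← (measurePreserving_piFinSuccAbove (fun _ : Fin (m + 1) => μ) 0).symm.integral_comp']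
  simp [MeasurableEquiv.piFinSuccAbove, Fin.insertNthEquiv]

theorem integrable_sum_pi {μ : Measure α} [IsProbabilityMeasure μ] {f : α → ℝ}
    (hf : Integrable f μ) (m : ℕ) :
    Integrable (fun a : Fin m → α => ∑ k, f (a k)) (Measure.pi fun _ => μ) :=
  integrable_finsetSum _ fun k _ =>
    (measurePreserving_eval (fun _ : Fin m => μ) k).integrable_comp_of_integrable hf

/- The arbitrary offsets `B` let the comparison on one coordinate be applied conditionally on all
the others. -/
theorem integral_iSup_sum_pi_le {μ : Measure α} [IsProbabilityMeasure μ]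
    (hf : ∀ i, Integrable (f i) μ) (hg : ∀ i, Integrable (g i) μ)
    (hfg : ∀ B : I → ℝ, ∫ a, ⨆ i, (B i + f i a) ∂μ ≤ ∫ a, ⨆ i, (B i + g i a) ∂μ)
    (m : ℕ) (B : I → ℝ) :
    ∫ a : Fin m → α, ⨆ i, (B i + ∑ k, f i (a k)) ∂(Measure.pi fun _ => μ) ≤
      ∫ a : Fin m → α, ⨆ i, (B i + ∑ k, g i (a k)) ∂(Measure.pi fun _ => μ) := by
  induction m generalizing B with
  | zero => simp
  | succ m ih =>
    rw [integral_pi_finSucc, integral_pi_finSucc]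
    simp only [Fin.sum_univ_succ, Fin.cons_zero, Fin.cons_succ]
    exact integral_iSup_prod_le hf hg (fun i => integrable_sum_pi (hf i) m)
      (fun i => integrable_sum_pi (hg i) m) hfg ih B

end Tensorization

end Symmetrization

section KernelSection

variable {E : Type*} [NormedAddCommGroup E] [InnerProductSpace ℝ E]

theorem mul_norm_sub_abs_inner_le {c : ℝ} (hc : 0 ≤ c) (g x y : E) :
    c * ‖x‖ - |inner ℝ g x| ≤ c * ‖y‖ - |inner ℝ g y| + (c + ‖g‖) * dist x y := by
  have hnorm : c * (‖x‖ - ‖y‖) ≤ c * dist x y :=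
    mul_le_mul_of_nonneg_left ((norm_sub_norm_le x y).trans_eq (dist_eq_norm x y).symm) hc
  have hinner : |inner ℝ g y| - |inner ℝ g x| ≤ ‖g‖ * dist x y := by
    refine (abs_sub_abs_le_abs_sub _ _).trans ?_
    rw [← inner_sub_right, dist_comm, dist_eq_norm]
    exact abs_real_inner_le_norm _ _
  linarith

variable [FiniteDimensional ℝ E] [MeasurableSpace E] [BorelSpace E] {K : Set E}

theorem integral_iSup_sum_norm_sub_abs_inner_le {I : Type*} [Finite I] [Nonempty I]
    (hK : Bornology.IsBounded K) {x : I → E} (hx : ∀ i, x i ∈ K) (m : ℕ) :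
    ∫ a : Fin m → E, ⨆ i, ∑ k, (√(2 / Real.pi) * ‖x i‖ - |inner ℝ (a k) (x i)|)
        ∂(Measure.pi fun _ => stdGaussian E) ≤ 2 * (√m * gaussianWidth K) := by
  have hinner : ∀ i, Integrable (fun w : E => inner ℝ w (x i)) (stdGaussian E) := fun i =>
    integrable_inner_stdGaussian (x i)
  have hsymm := integral_iSup_add_integral_abs_sub_abs_le_of_odd hinner
    fun i a => inner_neg_left a (x i)
  simp only [integral_abs_inner_stdGaussian] at hsymm
  have htensor := integral_iSup_sum_pi_le
    (fun i => (integrable_const _).sub (hinner i).abs) (fun i => (hinner i).const_mul 2)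
    hsymm m 0
  simp only [Pi.zero_apply, zero_add, Pi.sub_apply, ← Finset.mul_sum, ← sum_inner] at htensor
  refine htensor.trans ?_
  rw [← integral_supportFunction_sum_pi hK, ← integral_const_mul]
  refine integral_mono (integrable_iSup fun i => ?_)
    ((integrable_supportFunction_sum_pi hK m).const_mul 2) fun a => ciSup_le fun i =>
    mul_le_mul_of_nonneg_left (inner_le_supportFunction hK _ (hx i)) zero_le_two
  simp only [sum_inner]
  exact (integrable_sum_pi (hinner i) m).const_mul 2

variable {Ω : Type*} [MeasurableSpace Ω] {P : Measure Ω} {m : ℕ} {G : Ω → Fin m → E}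
  {h : Ω → E}

theorem mul_integral_norm_le_gaussianWidth
    (hG : HasLaw G (Measure.pi fun _ => stdGaussian E) P) (hK : Bornology.IsBounded K)
    (hint : Integrable h P) (hmem : ∀ᵐ ω ∂P, h ω ∈ K)
    (hker : ∀ᵐ ω ∂P, ∀ k, inner ℝ (G ω k) (h ω) = 0) :
    m * √(2 / Real.pi) * ∫ ω, ‖h ω‖ ∂P ≤ 2 * (√m * gaussianWidth K) := by
  have : IsProbabilityMeasure P := hG.isProbabilityMeasure
  have hne : K.Nonempty := hmem.exists.imp' h fun _ => id
  have hcomp : ∀ {f : E → ℝ}, Integrable f (stdGaussian E) →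
      Integrable (fun ω => ∑ k, f (G ω k)) P := fun hf =>
    (hG.map_eq ▸ integrable_sum_pi hf m).comp_aemeasurable hG.aemeasurable
  have hdeviation : ∀ x, Integrable
      (fun w => √(2 / Real.pi) * ‖x‖ - |inner ℝ w x|) (stdGaussian E) := fun x =>
    (integrable_const _).sub (integrable_inner_stdGaussian x).abs
  rw [← integral_const_mul]
  refine integral_le_of_forall_finite_integral_iSup_le
    (hK.isCompact_closure.totallyBounded.subset subset_closure) hne
    (f := fun x ω => ∑ k, (√(2 / Real.pi) * ‖x‖ - |inner ℝ (G ω k) x|))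
    (fun x _ => hcomp (hdeviation x)) (hint.norm.const_mul _)
    (hcomp ((integrable_const √(2 / Real.pi)).add integrable_norm_stdGaussian))
    (ae_of_all _ fun ω x _ y _ => ?_) ?_ fun F hFK hF hFne => ?_
  · rw [Finset.sum_mul, ← Finset.sum_add_distrib]
    exact Finset.sum_le_sum fun k _ => mul_norm_sub_abs_inner_le (by positivity) _ x y
  · filter_upwards [hmem, hker] with ω hω hω0 b hb
    simpa [hω0, mul_assoc] using hb (h ω) hω
  · have := hF.to_subtype
    have := hFne.to_subtype
    have hsup : Integrable (fun a : Fin m → E => ⨆ x : F, ∑ k, (√(2 / Real.pi) * ‖(x : E)‖ -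
        |inner ℝ (a k) (x : E)|)) (Measure.pi fun _ => stdGaussian E) :=
      integrable_iSup fun x => integrable_sum_pi (hdeviation x) m
    exact (hG.integral_comp hsup.aestronglyMeasurable).trans_le
      (integral_iSup_sum_norm_sub_abs_inner_le hK (fun x : F => hFK x.2) m)

theorem integral_norm_le_gaussianWidth (hm : 0 < m)
    (hG : HasLaw G (Measure.pi fun _ => stdGaussian E) P) (hK : Bornology.IsBounded K)
    (hint : Integrable h P) (hmem : ∀ᵐ ω ∂P, h ω ∈ K)
    (hker : ∀ᵐ ω ∂P, ∀ k, inner ℝ (G ω k) (h ω) = 0) :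
    ∫ ω, ‖h ω‖ ∂P ≤ √(2 * Real.pi) * (gaussianWidth K / √m) := by
  have hm' : (0 : ℝ) < m := Nat.cast_pos.2 hm
  have hconst : √(2 / Real.pi) * √(2 * Real.pi) = 2 := by
    rw [← Real.sqrt_mul (by positivity)]
    have hsq : 2 / Real.pi * (2 * Real.pi) = 2 ^ 2 := by field_simp
    rw [hsq, Real.sqrt_sq zero_le_two]
  refine le_of_mul_le_mul_left ?_ (mul_pos hm' (by positivity : 0 < √(2 / Real.pi)))
  calc m * √(2 / Real.pi) * ∫ ω, ‖h ω‖ ∂P ≤ 2 * (√m * gaussianWidth K) :=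
        mul_integral_norm_le_gaussianWidth hG hK hint hmem hker
    _ = √(2 / Real.pi) * √(2 * Real.pi) * (m / √m * gaussianWidth K) := by
        rw [hconst, Real.div_sqrt]
    _ = m * √(2 / Real.pi) * (√(2 * Real.pi) * (gaussianWidth K / √m)) := by ring

end KernelSection

section Polar

variable {E : Type*} [NormedAddCommGroup E] [InnerProductSpace ℝ E] {K : Set E}

theorem abs_inner_le_supportFunction (hK : Bornology.IsBounded K) (hneg : ∀ x ∈ K, -x ∈ K)
    (g : E) {x : E} (hx : x ∈ K) : |inner ℝ g x| ≤ supportFunction K g :=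
  abs_le'.2 ⟨inner_le_supportFunction hK g hx,
    (inner_neg_right g x).symm.trans_le (inner_le_supportFunction hK g (hneg x hx))⟩

theorem supportFunction_nonneg (hK : Bornology.IsBounded K) (hne : K.Nonempty)
    (hneg : ∀ x ∈ K, -x ∈ K) (g : E) : 0 ≤ supportFunction K g :=
  let ⟨_, hx⟩ := hne
  (abs_nonneg _).trans (abs_inner_le_supportFunction hK hneg g hx)

theorem supportFunction_sub_le (hK : Bornology.IsBounded K) (hne : K.Nonempty)
    (hneg : ∀ x ∈ K, -x ∈ K) (g g' : E) :
    supportFunction K (g - g') ≤ supportFunction K g + supportFunction K g' := by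
  refine supportFunction_le hne fun x hx => ?_
  rw [inner_sub_left, sub_eq_add_neg, ← inner_neg_right]
  exact add_le_add (inner_le_supportFunction hK g hx)
    (inner_le_supportFunction hK g' (hneg x hx))

/-- The one-sided polar `{y | ∀ x ∈ K, ⟨y, x⟩ ≤ 1}` of a nonempty bounded set `K`. When `K` is
symmetric and its support function is a norm, this is the unit ball of that norm, and the support
function of the polar is the dual norm. -/
def polarSet (K : Set E) : Set E := {y | supportFunction K y ≤ 1}

theorem zero_mem_polarSet (K : Set E) : (0 : E) ∈ polarSet K := by
  simp [polarSet, supportFunction_zero]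

theorem neg_mem_polarSet (hK : Bornology.IsBounded K) (hne : K.Nonempty)
    (hneg : ∀ x ∈ K, -x ∈ K) {y : E} (hy : y ∈ polarSet K) : -y ∈ polarSet K := by
  have h := supportFunction_sub_le hK hne hneg 0 y
  rw [zero_sub, supportFunction_zero, zero_add] at h
  exact h.trans hy

theorem inner_le_supportFunction_polarSet_mul (hK : Bornology.IsBounded K) (hne : K.Nonempty)
    (hneg : ∀ x ∈ K, -x ∈ K) (hpolar : Bornology.IsBounded (polarSet K)) (x y : E) :
    inner ℝ x y ≤ supportFunction (polarSet K) x * supportFunction K y := by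
  have hscale : ∀ t : ℝ, 0 ≤ t → t * supportFunction K y ≤ 1 →
      t * inner ℝ x y ≤ supportFunction (polarSet K) x := by
    intro t ht hty
    rw [← real_inner_smul_right]
    exact inner_le_supportFunction hpolar x ((supportFunction_smul K ht y).trans_le hty)
  rcases (supportFunction_nonneg hK hne hneg y).eq_or_lt' with hy | hy
  · rw [hy, mul_zero]
    by_contra! hxy
    have hnonneg := hscale 0 le_rfl (by simp)
    have ht := hscale ((supportFunction (polarSet K) x + 1) / inner ℝ x y) (by
      rw [zero_mul] at hnonneg
      positivity) (by simp [hy])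
    rw [div_mul_cancel₀ _ hxy.ne'] at ht
    linarith
  · have ht := hscale (supportFunction K y)⁻¹ (inv_nonneg.2 hy.le) (inv_mul_cancel₀ hy.ne').le
    rwa [inv_mul_le_iff₀ hy, mul_comm] at ht

theorem isBounded_setOf_supportFunction_polarSet_le (hK : Bornology.IsBounded K)
    (hne : K.Nonempty) (hneg : ∀ x ∈ K, -x ∈ K) (hpolar : Bornology.IsBounded (polarSet K))
    (R : ℝ) : Bornology.IsBounded {x | supportFunction (polarSet K) x ≤ R} := by
  obtain ⟨C, hC⟩ := hK.exists_norm_le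
  refine isBounded_iff_forall_norm_le.2 ⟨R * C, fun x hx => ?_⟩
  have hR : 0 ≤ R := by
    have hzero := inner_le_supportFunction hpolar x (zero_mem_polarSet K)
    rw [inner_zero_right] at hzero
    exact hzero.trans hx
  have hle : supportFunction K x ≤ ‖x‖ * C := supportFunction_le hne fun y hy =>
    (real_inner_le_norm x y).trans (mul_le_mul_of_nonneg_left (hC y hy) (norm_nonneg x))
  rcases (norm_nonneg x).eq_or_lt' with hx0 | hx0
  · obtain ⟨y, hy⟩ := hne
    rw [hx0]
    exact mul_nonneg hR ((norm_nonneg y).trans (hC y hy))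
  refine le_of_mul_le_mul_right ?_ hx0
  calc ‖x‖ * ‖x‖ = inner ℝ x x := (real_inner_self_eq_norm_mul_norm x).symm
    _ ≤ supportFunction (polarSet K) x * supportFunction K x :=
        inner_le_supportFunction_polarSet_mul hK hne hneg hpolar x x
    _ ≤ R * (‖x‖ * C) := mul_le_mul hx hle (supportFunction_nonneg hK hne hneg x) hR
    _ = R * C * ‖x‖ := by ring

theorem gaussianWidth_setOf_supportFunction_polarSet_le [FiniteDimensional ℝ E]
    [MeasurableSpace E] [BorelSpace E] (hK : Bornology.IsBounded K) (hne : K.Nonempty)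
    (hneg : ∀ x ∈ K, -x ∈ K) (hpolar : Bornology.IsBounded (polarSet K)) {R : ℝ} (hR : 0 ≤ R) :
    gaussianWidth {x | supportFunction (polarSet K) x ≤ R} ≤ R * gaussianWidth K := by
  have hball : {x | supportFunction (polarSet K) x ≤ R}.Nonempty :=
    ⟨0, (supportFunction_zero _).trans_le hR⟩
  rw [gaussianWidth, gaussianWidth, ← integral_const_mul]
  refine integral_mono (integrable_supportFunction
    (isBounded_setOf_supportFunction_polarSet_le hK hne hneg hpolar R))
    ((integrable_supportFunction hK).const_mul R) fun g => supportFunction_le hball fun x hx => ?_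
  rw [real_inner_comm]
  exact (inner_le_supportFunction_polarSet_mul hK hne hneg hpolar x g).trans
    (mul_le_mul_of_nonneg_right hx (supportFunction_nonneg hK hne hneg g))

end Polar

theorem one_sub_prod_le_sum_one_sub {ι : Type*} (s : Finset ι) {a : ι → ℝ}
    (ha : ∀ i, |a i| ≤ 1) : 1 - ∏ i ∈ s, a i ≤ ∑ i ∈ s, (1 - a i) := by
  classical
  induction s using Finset.induction_on with
  | empty => simp
  | insert i s hi ih =>
    rw [Finset.prod_insert hi, Finset.sum_insert hi]
    have hprod : ∏ j ∈ s, a j ≤ 1 := (le_abs_self _).trans <| by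
      rw [Finset.abs_prod]
      exact Finset.prod_le_one (fun _ _ => abs_nonneg _) fun j _ => ha j
    linarith [mul_nonneg (sub_nonneg.2 (abs_le.1 (ha i)).2) (sub_nonneg.2 hprod)]

namespace RealTensor

variable {D : ℕ} {n : Fin D → ℕ}

theorem inner_elementary (u v : (d : Fin D) → EuclideanSpace ℝ (Fin (n d))) :
    inner ℝ (elementary u) (elementary v) = ∏ d, inner ℝ (u d) (v d) := by
  simp only [PiLp.inner_apply, elementary, RCLike.inner_apply, conj_trivial]
  rw [Finset.prod_univ_sum, Fintype.piFinset_univ]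
  simp_rw [Finset.prod_mul_distrib]

theorem norm_elementary (u : (d : Fin D) → EuclideanSpace ℝ (Fin (n d))) :
    ‖elementary u‖ = ∏ d, ‖u d‖ := by
  have h : ‖elementary u‖ ^ 2 = (∏ d, ‖u d‖) ^ 2 := by
    rw [← real_inner_self_eq_norm_sq, inner_elementary, ← Finset.prod_pow]
    simp_rw [real_inner_self_eq_norm_sq]
  exact (pow_left_inj₀ (norm_nonneg _) (Finset.prod_nonneg fun d _ => norm_nonneg _)
    two_ne_zero).1 h

theorem elementary_update_neg (u : (d : Fin D) → EuclideanSpace ℝ (Fin (n d))) (d : Fin D) :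
    elementary (Function.update u d (-u d)) = -elementary u := by
  ext i
  simp only [elementary, PiLp.neg_apply]
  rw [← Finset.mul_prod_erase _ _ (Finset.mem_univ d),
    ← Finset.mul_prod_erase _ (fun e => u e (i e)) (Finset.mem_univ d), Function.update_self,
    PiLp.neg_apply, neg_mul]
  refine congrArg _ (congrArg _ (Finset.prod_congr rfl fun e he => ?_))
  rw [Function.update_of_ne (Finset.ne_of_mem_erase he)]

theorem elementary_single (i : (d : Fin D) → Fin (n d)) :
    elementary (fun d => EuclideanSpace.single (i d) (1 : ℝ)) =
      (EuclideanSpace.single i 1 : RealTensor n) := by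
  ext j
  simp only [elementary, PiLp.single_apply]
  rw [Finset.prod_ite_zero]
  simp [funext_iff]

theorem norm_elementary_sub_le {u v : (d : Fin D) → EuclideanSpace ℝ (Fin (n d))}
    (hu : ∀ d, ‖u d‖ = 1) (hv : ∀ d, ‖v d‖ = 1) :
    ‖elementary u - elementary v‖ ≤ ‖WithLp.toLp 2 u - WithLp.toLp 2 v‖ := by
  refine (pow_le_pow_iff_left₀ (norm_nonneg _) (norm_nonneg _) two_ne_zero).1 ?_
  have hprod : 1 - ∏ d, inner ℝ (u d) (v d) ≤ ∑ d, (1 - inner ℝ (u d) (v d)) :=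
    one_sub_prod_le_sum_one_sub Finset.univ fun d => by
      simpa [hu, hv] using abs_real_inner_le_norm (u d) (v d)
  calc ‖elementary u - elementary v‖ ^ 2 = 2 * (1 - ∏ d, inner ℝ (u d) (v d)) := by
        rw [norm_sub_sq_real, inner_elementary, norm_elementary, norm_elementary]
        simp only [hu, hv, Finset.prod_const_one]
        ring
    _ ≤ 2 * ∑ d, (1 - inner ℝ (u d) (v d)) := mul_le_mul_of_nonneg_left hprod zero_le_two
    _ = ‖WithLp.toLp 2 u - WithLp.toLp 2 v‖ ^ 2 := by
        rw [PiLp.norm_sq_eq_of_L2, Finset.mul_sum]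
        refine Finset.sum_congr rfl fun d _ => ?_
        rw [PiLp.sub_apply, norm_sub_sq_real, hu, hv]
        ring

/-- The set of elementary tensors `u 0 ⊗ ⋯ ⊗ u (D - 1)` of Euclidean unit vectors, of which the
spectral norm is the support function. -/
def unitElementary (n : Fin D → ℕ) : Set (RealTensor n) := elementary '' {u | ∀ d, ‖u d‖ = 1}

theorem spectralNorm_eq_supportFunction (X : RealTensor n) :
    spectralNorm X = supportFunction (unitElementary n) X := by
  rw [spectralNorm, supportFunction, ← sSup_image']
  congr 1
  ext r
  simp [unitElementary, and_comm, eq_comm]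

theorem nuclearNorm_eq_supportFunction (X : RealTensor n) :
    nuclearNorm X = supportFunction (polarSet (unitElementary n)) X := by
  rw [nuclearNorm, supportFunction, ← sSup_image']
  simp only [spectralNorm_eq_supportFunction]
  congr 1
  ext r
  simp [polarSet, and_comm, eq_comm]

theorem isBounded_unitElementary : Bornology.IsBounded (unitElementary n) := by
  refine isBounded_iff_forall_norm_le.2 ⟨1, ?_⟩
  rintro _ ⟨u, hu, rfl⟩
  rw [norm_elementary, Finset.prod_eq_one fun d _ => hu d]

theorem nonempty_unitElementary (hn : ∀ d, 0 < n d) : (unitElementary n).Nonempty :=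
  ⟨_, fun d => EuclideanSpace.single ⟨0, hn d⟩ 1, fun d => by simp, rfl⟩

theorem neg_mem_unitElementary (hD : 0 < D) : ∀ X ∈ unitElementary n, -X ∈ unitElementary n := by
  rintro _ ⟨u, hu, rfl⟩
  refine ⟨Function.update u ⟨0, hD⟩ (-u ⟨0, hD⟩), fun d => ?_, elementary_update_neg u _⟩
  rcases eq_or_ne d ⟨0, hD⟩ with rfl | hd
  · rw [Function.update_self, norm_neg, hu]
  · rw [Function.update_of_ne hd, hu]

theorem isBounded_polarSet_unitElementary (hD : 0 < D) :
    Bornology.IsBounded (polarSet (unitElementary n)) := by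
  refine isBounded_iff_forall_norm_le.2
    ⟨√(Fintype.card ((d : Fin D) → Fin (n d))), fun X hX => ?_⟩
  have hentry : ∀ i, ‖X i‖ ≤ 1 := by
    intro i
    have hmem : (EuclideanSpace.single i 1 : RealTensor n) ∈ unitElementary n :=
      ⟨_, fun d => by simp, elementary_single i⟩
    have h := abs_inner_le_supportFunction isBounded_unitElementary (neg_mem_unitElementary hD)
      X hmem
    rw [EuclideanSpace.inner_single_right, one_mul, conj_trivial] at h
    exact h.trans hX
  rw [EuclideanSpace.norm_eq]
  refine Real.sqrt_le_sqrt ?_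
  calc ∑ i, ‖X i‖ ^ 2 ≤ ∑ _i : (d : Fin D) → Fin (n d), (1 : ℝ) :=
        Finset.sum_le_sum fun i _ => pow_le_one₀ (norm_nonneg _) (hentry i)
    _ = Fintype.card ((d : Fin D) → Fin (n d)) := by simp

theorem integrable_norm_eval_stdGaussian (d : Fin D) :
    Integrable (fun w : PiLp 2 fun d => EuclideanSpace ℝ (Fin (n d)) => ‖w d‖)
      (stdGaussian _) := by
  have h := integrable_norm_stdGaussian (E := EuclideanSpace ℝ (Fin (n d)))
  rw [← map_eval_stdGaussian (F := fun d => EuclideanSpace ℝ (Fin (n d))) d] at h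
  exact h.comp_measurable (by fun_prop)

theorem integral_sum_norm_eval_stdGaussian_le :
    ∫ w : PiLp 2 fun d => EuclideanSpace ℝ (Fin (n d)), ∑ d, ‖w d‖ ∂(stdGaussian _) ≤
      ∑ d, √(n d : ℝ) := by
  rw [integral_finsetSum _ fun d _ => integrable_norm_eval_stdGaussian d]
  refine Finset.sum_le_sum fun d _ => ?_
  rw [← integral_map (φ := fun w : PiLp 2 fun d => EuclideanSpace ℝ (Fin (n d)) => w d)
    (f := norm) (by fun_prop) (by fun_prop),
    map_eval_stdGaussian (F := fun d => EuclideanSpace ℝ (Fin (n d))) d]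
  simpa using integral_norm_stdGaussian_le (E := EuclideanSpace ℝ (Fin (n d)))

theorem gaussianWidth_unitElementary_le (hn : ∀ d, 0 < n d) :
    gaussianWidth (unitElementary n) ≤ ∑ d, √(n d : ℝ) := by
  let U : Set ((d : Fin D) → EuclideanSpace ℝ (Fin (n d))) := {u | ∀ d, ‖u d‖ = 1}
  have : Nonempty U := (Set.image_nonempty.1 (nonempty_unitElementary hn)).to_subtype
  let y : U → PiLp 2 fun d => EuclideanSpace ℝ (Fin (n d)) := fun u => WithLp.toLp 2 u.1
  have hnorm : ∀ (u : U) d, ‖u.1 d‖ = 1 := Subtype.property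
  have hy : Bornology.IsBounded (Set.range y) := by
    refine isBounded_iff_forall_norm_le.2 ⟨√D, ?_⟩
    rintro _ ⟨u, rfl⟩
    rw [PiLp.norm_eq_of_L2]
    simp [y, hnorm]
  have hsup : ∀ w, supportFunction (Set.range y) w ≤ ∑ d, ‖w d‖ := by
    refine fun w => supportFunction_le (Set.range_nonempty y) ?_
    rintro _ ⟨u, rfl⟩
    rw [PiLp.inner_apply]
    exact Finset.sum_le_sum fun d _ => by simpa [y, hnorm] using real_inner_le_norm (w d) (u.1 d)
  calc gaussianWidth (unitElementary n) ≤ gaussianWidth (Set.range y) := by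
        rw [unitElementary, Set.image_eq_range]
        exact gaussianWidth_range_le_of_norm_sub_le hy fun u v => norm_elementary_sub_le u.2 v.2
    _ ≤ ∫ w : PiLp 2 fun d => EuclideanSpace ℝ (Fin (n d)), ∑ d, ‖w d‖ ∂(stdGaussian _) :=
        integral_mono (integrable_supportFunction hy)
          (integrable_finsetSum _ fun d _ => integrable_norm_eval_stdGaussian d) hsup
    _ ≤ ∑ d, √(n d : ℝ) := integral_sum_norm_eval_stdGaussian_le

theorem isBounded_setOf_nuclearNorm_le (hD : 0 < D) (hn : ∀ d, 0 < n d) (R : ℝ) :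
    Bornology.IsBounded {X : RealTensor n | nuclearNorm X ≤ R} := by
  simp only [nuclearNorm_eq_supportFunction]
  exact isBounded_setOf_supportFunction_polarSet_le isBounded_unitElementary
    (nonempty_unitElementary hn) (neg_mem_unitElementary hD)
    (isBounded_polarSet_unitElementary hD) R

theorem gaussianWidth_setOf_nuclearNorm_le (hD : 0 < D) (hn : ∀ d, 0 < n d) {R : ℝ}
    (hR : 0 ≤ R) :
    gaussianWidth {X : RealTensor n | nuclearNorm X ≤ R} ≤ R * ∑ d, √(n d : ℝ) := by
  simp only [nuclearNorm_eq_supportFunction]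
  exact (gaussianWidth_setOf_supportFunction_polarSet_le isBounded_unitElementary
    (nonempty_unitElementary hn) (neg_mem_unitElementary hD)
    (isBounded_polarSet_unitElementary hD) hR).trans
    (mul_le_mul_of_nonneg_left (gaussianWidth_unitElementary_le hn) hR)

theorem neg_mem_polarSet_unitElementary (hD : 0 < D) (hn : ∀ d, 0 < n d) :
    ∀ X ∈ polarSet (unitElementary n), -X ∈ polarSet (unitElementary n) := fun _ =>
  neg_mem_polarSet isBounded_unitElementary (nonempty_unitElementary hn)
    (neg_mem_unitElementary hD)

theorem nuclearNorm_nonneg (hD : 0 < D) (X : RealTensor n) : 0 ≤ nuclearNorm X := by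
  have h := inner_le_supportFunction (isBounded_polarSet_unitElementary hD) X
    (zero_mem_polarSet (unitElementary n))
  rwa [inner_zero_right, ← nuclearNorm_eq_supportFunction] at h

theorem nuclearNorm_sub_le (hD : 0 < D) (hn : ∀ d, 0 < n d) (X Y : RealTensor n) :
    nuclearNorm (X - Y) ≤ nuclearNorm X + nuclearNorm Y := by
  simp only [nuclearNorm_eq_supportFunction]
  exact supportFunction_sub_le (isBounded_polarSet_unitElementary hD) ⟨0, zero_mem_polarSet _⟩
    (neg_mem_polarSet_unitElementary hD hn) X Y

namespace IsNuclearNormSolution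

variable {m : ℕ} {G : Fin m → RealTensor n} {y : Fin m → ℝ} {X X' : RealTensor n}

theorem inner_sub_eq_zero (hX : IsNuclearNormSolution G y X)
    (hX' : ∀ i, inner ℝ (G i) X' = y i) (i : Fin m) : inner ℝ (G i) (X - X') = 0 := by
  rw [inner_sub_right, hX.1 i, hX' i, sub_self]

theorem nuclearNorm_sub_le_two_mul (hD : 0 < D) (hn : ∀ d, 0 < n d)
    (hX : IsNuclearNormSolution G y X) (hX' : ∀ i, inner ℝ (G i) X' = y i) :
    nuclearNorm (X - X') ≤ 2 * nuclearNorm X' := by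
  linarith [nuclearNorm_sub_le hD hn X X', hX.2 X' hX']

end IsNuclearNormSolution

theorem IsStdGaussian.hasLaw {Ω : Type*} [MeasurableSpace Ω] {P : Measure Ω}
    {G : Ω → RealTensor n} (hG : IsStdGaussian G P) :
    HasLaw G (stdGaussian (RealTensor n)) P := by
  have hpi := iIndepFun.hasLaw_pi hG.hasLaw_entry hG.indep_entries
  refine ⟨(by fun_prop : Measurable (WithLp.toLp 2)).comp_aemeasurable hpi.aemeasurable, ?_⟩
  rw [← map_pi_eq_stdGaussian, ← hpi.map_eq,
    AEMeasurable.map_map_of_aemeasurable (by fun_prop) hpi.aemeasurable]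
  rfl

end RealTensor

theorem mainTheorem1 {D : ℕ} (hD : 0 < D) (n : Fin D → ℕ) (hn : ∀ d, 0 < n d)
    {m : ℕ} (hm : 0 < m)
    {Ω : Type*} [MeasurableSpace Ω] (P : Measure Ω) [IsProbabilityMeasure P]
    (G : Fin m → Ω → RealTensor n)
    (hGauss : ∀ i, RealTensor.IsStdGaussian (G i) P)
    (hIndep : iIndepFun G P)
    (Xsharp : RealTensor n)
    (y : Fin m → Ω → ℝ) (hy : ∀ i ω, y i ω = inner ℝ (G i ω) Xsharp)
    (Xhat : Ω → RealTensor n) (hXhat_meas : AEMeasurable Xhat P)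
    (hXhat : ∀ᵐ ω ∂P,
      RealTensor.IsNuclearNormSolution (fun i => G i ω) (fun i => y i ω) (Xhat ω)) :
    Integrable (fun ω => ‖Xhat ω - Xsharp‖) P ∧
      ∫ ω, ‖Xhat ω - Xsharp‖ ∂P ≤
        4 * √Real.pi * ((∑ d, √(n d : ℝ)) / √(m : ℝ)) * RealTensor.nuclearNorm Xsharp := by
  have hR : 0 ≤ RealTensor.nuclearNorm Xsharp := RealTensor.nuclearNorm_nonneg hD Xsharp
  let K : Set (RealTensor n) := {X | RealTensor.nuclearNorm X ≤ 2 * RealTensor.nuclearNorm Xsharp}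
  have hK : Bornology.IsBounded K := RealTensor.isBounded_setOf_nuclearNorm_le hD hn _
  have hlaw := iIndepFun.hasLaw_pi (fun i => (hGauss i).hasLaw) hIndep
  have hmem : ∀ᵐ ω ∂P, Xhat ω - Xsharp ∈ K := hXhat.mono fun ω hω =>
    hω.nuclearNorm_sub_le_two_mul hD hn fun i => (hy i ω).symm
  have hker : ∀ᵐ ω ∂P, ∀ i, inner ℝ (G i ω) (Xhat ω - Xsharp) = 0 := hXhat.mono fun ω hω =>
    hω.inner_sub_eq_zero fun i => (hy i ω).symm
  obtain ⟨C, hC⟩ := hK.exists_norm_le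
  have hint : Integrable (fun ω => Xhat ω - Xsharp) P :=
    .of_bound (hXhat_meas.sub_const Xsharp).aestronglyMeasurable C (hmem.mono fun ω => hC _)
  have hpi : √(2 * Real.pi) ≤ 2 * √Real.pi := by
    rw [Real.sqrt_mul zero_le_two]
    exact mul_le_mul_of_nonneg_right (Real.sqrt_le_iff.2 (by norm_num)) (Real.sqrt_nonneg _)
  refine ⟨hint.norm, (integral_norm_le_gaussianWidth hm hlaw hK hint hmem hker).trans ?_⟩
  calc √(2 * Real.pi) * (gaussianWidth K / √m)
      ≤ √(2 * Real.pi) * (2 * RealTensor.nuclearNorm Xsharp * (∑ d, √(n d : ℝ)) / √m) := by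
        gcongr
        exact RealTensor.gaussianWidth_setOf_nuclearNorm_le hD hn (by positivity)
    _ ≤ 2 * √Real.pi * (2 * RealTensor.nuclearNorm Xsharp * (∑ d, √(n d : ℝ)) / √m) := by gcongr
    _ = 4 * √Real.pi * ((∑ d, √(n d : ℝ)) / √m) * RealTensor.nuclearNorm Xsharp := by ring
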